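/- \textbf{Proposition.} Let $E$, $F$ be sequentially complete Hausdorff locally convex real topological vector spaces, let $a<b$ be real numbers, let $V\subseteq E$ be an open subset, $p\in[1,\infty]$ and $k\in\mathbb{N}\cup\{0,\infty\}$ (with $\infty+2=\infty$). If $f\colon V\to F$ is a $C^{k+2}$-map, then $AC_{L^p}([a,b],V)$ is open in $AC_{L^p}([a,b],E)$, one has $f\circ\eta\in AC_{L^p}([a,b],F)$ for every $\eta\in AC_{L^p}([a,b],V)$, and the map $$AC_{L^p}([a,b],f)\colon AC_{L^p}([a,b],V)\to AC_{L^p}([a,b],F),\qquad \eta\mapsto f\circ\eta,$$ is $C^k$. Here the following notions are used. \emph{$C^k$-maps} (Bastiani/Keller). A map $g\colon U\to Y$ from an open subset $U$ of a locally convex space $X$ to a locally convex space $Y$ is $C^0$ if it is continuous; it is $C^{n+1}$ if it is continuous, the directional derivative $dg(x,y)=\lim_{h\to0}h^{-1}(g(x+hy)-g(x))$ exists for all $x\in U$, $y\in X$, and $dg\colon U\times X\to Y$ is $C^n$; it is $C^\infty$ if it is $C^n$ for all $n\in\mathbb{N}$. \emph{Lebesgue spaces.} A function $\gamma\colon[a,b]\to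 E$ is (Lusin) measurable if for each compact $K\subseteq[a,b]$ there are compact sets $K_1,K_2,\ldots\subseteq K$ such that each $\gamma|_{K_n}$ is continuous and $K\setminus\bigcup_n K_n$ has Lebesgue measure $0$. $\mathcal{L}^p([a,b],E)$ is the vector space of measurable $\gamma$ such that, for every continuous seminorm $q$ on $E$, the (Lebesgue measurable) function $q\circ\gamma$ is $p$-integrable if $p<\infty$, and essentially bounded if $p=\infty$. $L^p([a,b],E)$ is its quotient by equality almost everywhere, with the locally convex topology defined by the seminorms $\|[\gamma]\|_{L^p,q}=\|q\circ\gamma\|_{\mathcal{L}^p}$. \emph{Absolutely continuous functions.} $AC_{L^p}([a,b],E)$ is the vector space of continuous functions $\eta\colon[a,b]\to E$ for which there is some $\gamma\in\mathcal{L}^p([a,b],E)$ with $\eta(t)=\eta(a)+\int_a^t\gamma(s)\,ds$ for all $t\in[a,b]$, the integral being a weak integral (that is, $\alpha(\eta(t)-\eta(a))=\int_a^t\alpha(\gamma(s))\,ds$ for all continuous linear functionals $\alpha$ on $E$). The class $\eta':=[\gamma]\in L^p([a,b],E)$ is uniquely determined by $\eta$, and $AC_{L^p}([a,b],E)$ carries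 the topology induced by the injective linear map $\eta\mapsto(\eta(a),\eta')$ into $E\times L^p([a,b],E)$. Finally, $AC_{L^p}([a,b],V)$ is the set of all $\eta\in AC_{L^p}([a,b],E)$ with $\eta([a,b])\subseteq V$. -/

import Mathlib

open MeasureTheory Set Filter Topology
open scoped ENNReal

set_option linter.unusedSectionVars false

universe u v

/-! ### Sequential completeness and Keller's `C^k_c`-calculus -/

/-- Every Cauchy sequence converges. -/
def IsSeqCompleteSpace (E : Type u) [UniformSpace E] : Prop :=
  ∀ s : ℕ → E, CauchySeq s → ∃ x : E, Tendsto s atTop (𝓝 x)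

/-- `f` (a total function, of which only the values on the open set `U` matter) is a `C^n`-map
on `U`, in the sense of Bastiani/Keller: `f` is continuous on `U`, all directional derivatives
`df (x, y)`, `x ∈ U`, `y ∈ E`, exist, and `df` is a `C^(n-1)`-map on `U × E`. -/
def IsCnMapOn : ℕ → ∀ {E : Type u} [AddCommGroup E] [Module ℝ E] [TopologicalSpace E]
    {F : Type v} [AddCommGroup F] [Module ℝ F] [TopologicalSpace F], (E → F) → Set E → Prop
  | 0, _, _, _, _, _, _, _, _, f, U => ContinuousOn f U
  | n + 1, E, _, _, _, F, _, _, _, f, U =>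
      ContinuousOn f U ∧ ∃ df : E × E → F,
        (∀ x ∈ U, ∀ y : E,
          Tendsto (fun h : ℝ => h⁻¹ • (f (x + h • y) - f x)) (𝓝[≠] 0) (𝓝 (df (x, y)))) ∧
        IsCnMapOn n df (U ×ˢ univ)

/-- `C^k`-maps for `k ∈ ℕ ∪ {∞}`. -/
def IsCkMapOn (k : ℕ∞) {E : Type u} [AddCommGroup E] [Module ℝ E] [TopologicalSpace E]
    {F : Type v} [AddCommGroup F] [Module ℝ F] [TopologicalSpace F] (f : E → F) (U : Set E) :
    Prop :=
  ∀ n : ℕ, (n : ℕ∞) ≤ k → IsCnMapOn n f U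

/-! ### Lusin measurable functions -/

/-- Lusin `μ`-measurability: every compact set is, up to a null set, a countable union of compact
sets on each of which `γ` is continuous. -/
def LusinMeasurable {X : Type*} {Y : Type*} [TopologicalSpace X] [MeasurableSpace X]
    [TopologicalSpace Y] (γ : X → Y) (μ : Measure X) : Prop :=
  ∀ K : Set X, IsCompact K → ∃ C : ℕ → Set X,
    (∀ n, IsCompact (C n) ∧ C n ⊆ K ∧ ContinuousOn γ (C n)) ∧ μ (K \ ⋃ n, C n) = 0

namespace LusinMeasurable

variable {X Y Z : Type*} [TopologicalSpace X] [MeasurableSpace X] [TopologicalSpace Y]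
  [TopologicalSpace Z] {μ : Measure X}

theorem comp_continuous {γ : X → Y} (hγ : LusinMeasurable γ μ) {f : Y → Z} (hf : Continuous f) :
    LusinMeasurable (fun x => f (γ x)) μ := by
  intro K hK
  obtain ⟨C, hC, hn⟩ := hγ K hK
  exact ⟨C, fun n => ⟨(hC n).1, (hC n).2.1, hf.comp_continuousOn (hC n).2.2⟩, hn⟩

theorem of_continuous {γ : X → Y} (hγ : Continuous γ) : LusinMeasurable γ μ := by
  intro K hK
  exact ⟨fun _ => K, fun _ => ⟨hK, subset_rfl, hγ.continuousOn⟩, by simp [iUnion_const]⟩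

theorem prodMk [T2Space X] {γ : X → Y} {δ : X → Z} (hγ : LusinMeasurable γ μ)
    (hδ : LusinMeasurable δ μ) : LusinMeasurable (fun x => (γ x, δ x)) μ := by
  intro K hK
  obtain ⟨C, hC, hCn⟩ := hγ K hK
  obtain ⟨D, hD, hDn⟩ := hδ K hK
  refine ⟨fun n => C n.unpair.1 ∩ D n.unpair.2, fun n => ⟨?_, ?_, ?_⟩, ?_⟩
  · exact (hC _).1.inter (hD _).1
  · exact inter_subset_left.trans (hC _).2.1
  · exact ((hC _).2.2.mono inter_subset_left).prodMk ((hD _).2.2.mono inter_subset_right)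
  · refine measure_mono_null ?_ (measure_union_null hCn hDn)
    rintro x ⟨hxK, hx⟩
    by_contra hcon
    simp only [mem_union, Set.mem_sdiff, not_or, not_and, not_not] at hcon
    obtain ⟨i, hi⟩ := mem_iUnion.1 (hcon.1 hxK)
    obtain ⟨j, hj⟩ := mem_iUnion.1 (hcon.2 hxK)
    exact hx (mem_iUnion.2 ⟨Nat.pair i j, by simpa using ⟨hi, hj⟩⟩)

theorem aestronglyMeasurable [CompactSpace X] [T2Space X] [BorelSpace X] {γ : X → ℝ}
    (hγ : LusinMeasurable γ μ) : AEStronglyMeasurable γ μ := by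
  obtain ⟨C, hC, hn⟩ := hγ univ isCompact_univ
  have h1 : AEStronglyMeasurable γ (μ.restrict (⋃ n, C n)) := by
    rw [aestronglyMeasurable_iUnion_iff]
    exact fun n => (hC n).2.2.aestronglyMeasurable (hC n).1.measurableSet
  rwa [Measure.restrict_eq_self_of_ae_mem] at h1
  rw [ae_iff]
  simpa [← compl_eq_univ_sdiff, compl_def] using hn

end LusinMeasurable

/-! ### Lebesgue spaces of functions with values in a locally convex space -/

/-- Lebesgue measure on the interval `[a,b]`. -/
noncomputable def lebIcc (a b : ℝ) : Measure (Icc a b) := volume.comap Subtype.val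

instance (a b : ℝ) : IsFiniteMeasure (lebIcc a b) where
  measure_univ_lt_top := by
    rw [lebIcc, comap_subtype_coe_apply measurableSet_Icc, image_univ, Subtype.range_coe]
    exact measure_Icc_lt_top

/-- The index set of all continuous seminorms on `E`. -/
abbrev ContSeminorm (E : Type u) [AddCommGroup E] [Module ℝ E] [TopologicalSpace E] : Type u :=
  {q : Seminorm ℝ E // Continuous q}

section Lebesgue

variable (p : ℝ≥0∞) (a b : ℝ) (E : Type u) [AddCommGroup E] [Module ℝ E] [TopologicalSpace E]
  [IsTopologicalAddGroup E] [ContinuousSMul ℝ E]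

/-- The space of Lusin measurable functions `γ : [a,b] → E` (with respect to Lebesgue measure)
such that `q ∘ γ` is an `ℒ^p`-function for every continuous seminorm `q` on `E`. -/
def CurlyLp : Submodule ℝ (Icc a b → E) where
  carrier := {γ | LusinMeasurable γ (lebIcc a b) ∧
    ∀ q : Seminorm ℝ E, Continuous q → MemLp (fun t => q (γ t)) p (lebIcc a b)}
  add_mem' := by
    rintro γ δ ⟨hγ, hγp⟩ ⟨hδ, hδp⟩
    have hm : LusinMeasurable (γ + δ) (lebIcc a b) := (hγ.prodMk hδ).comp_continuous continuous_add
    refine ⟨hm, fun q hq => ((hγp q hq).add (hδp q hq)).mono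
      (hm.comp_continuous hq).aestronglyMeasurable (ae_of_all _ fun t => ?_)⟩
    simp only [Pi.add_apply, Real.norm_eq_abs]
    rw [abs_of_nonneg (apply_nonneg q _)]
    exact (map_add_le_add q _ _).trans (le_abs_self _)
  zero_mem' := by
    refine ⟨LusinMeasurable.of_continuous continuous_const, fun q hq => ?_⟩
    simp
  smul_mem' := by
    rintro c γ ⟨hγ, hγp⟩
    refine ⟨hγ.comp_continuous (continuous_const_smul c), fun q hq => ?_⟩
    simpa [map_smul_eq_mul] using (hγp q hq).const_mul ‖c‖

/-- The functions in `ℒ^p([a,b],E)` that vanish almost everywhere. -/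
def CurlyLp.null : Submodule ℝ (CurlyLp p a b E) where
  carrier := {γ | ∀ᵐ t ∂(lebIcc a b), γ.1 t = 0}
  add_mem' := by
    intro γ δ hγ hδ
    change ∀ᵐ t ∂(lebIcc a b), (γ + δ).1 t = 0
    filter_upwards [hγ, hδ] with t h1 h2
    simp [h1, h2]
  zero_mem' := by simp
  smul_mem' := by
    intro c γ hγ
    change ∀ᵐ t ∂(lebIcc a b), (c • γ).1 t = 0
    filter_upwards [hγ] with t h
    simp [h]

/-- `L^p([a,b],E)`: the quotient of `ℒ^p([a,b],E)` by equality almost everywhere. -/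
def LpSpace : Type u := CurlyLp p a b E ⧸ CurlyLp.null p a b E

instance : AddCommGroup (LpSpace p a b E) :=
  inferInstanceAs (AddCommGroup (CurlyLp p a b E ⧸ CurlyLp.null p a b E))

instance : Module ℝ (LpSpace p a b E) :=
  inferInstanceAs (Module ℝ (CurlyLp p a b E ⧸ CurlyLp.null p a b E))

variable {p a b E}

/-- The class `[γ]` of `γ`. -/
def LpSpace.mk : CurlyLp p a b E →ₗ[ℝ] LpSpace p a b E := (CurlyLp.null p a b E).mkQ

theorem LpSpace.mk_eq_mk {γ δ : CurlyLp p a b E} :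
    LpSpace.mk γ = LpSpace.mk δ ↔ ∀ᵐ t ∂(lebIcc a b), γ.1 t = δ.1 t := by
  have h := Submodule.Quotient.eq (CurlyLp.null p a b E) (x := γ) (y := δ)
  refine Iff.trans h ?_
  change (∀ᵐ t ∂(lebIcc a b), (γ - δ).1 t = 0) ↔ _
  simp [sub_eq_zero]

theorem LpSpace.mk_surjective : Function.Surjective (LpSpace.mk (p := p) (a := a) (b := b) (E := E)) :=
  Submodule.mkQ_surjective _

/-- The seminorm `‖[γ]‖_{L^p,q} = ‖q ∘ γ‖_{ℒ^p}` on `L^p([a,b],E)`. -/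
noncomputable def LpSpace.seminorm [Fact (1 ≤ p)] (q : ContSeminorm E) :
    Seminorm ℝ (LpSpace p a b E) :=
  Seminorm.of
    (fun x => Quotient.liftOn' x
      (fun γ : CurlyLp p a b E => (eLpNorm (fun t => q.1 (γ.1 t)) p (lebIcc a b)).toReal)
      (fun γ δ h => by
        have h' : ∀ᵐ t ∂(lebIcc a b), γ.1 t = δ.1 t := LpSpace.mk_eq_mk.1 (Quotient.sound' h)
        refine congrArg _ (eLpNorm_congr_ae ?_)
        filter_upwards [h'] with t ht
        rw [ht]))
    (fun x y => by
      obtain ⟨γ, rfl⟩ := LpSpace.mk_surjective x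
      obtain ⟨δ, rfl⟩ := LpSpace.mk_surjective y
      have hγ := γ.2.2 q.1 q.2
      have hδ := δ.2.2 q.1 q.2
      change (eLpNorm (fun t => q.1 (γ.1 t + δ.1 t)) p (lebIcc a b)).toReal ≤
        (eLpNorm (fun t => q.1 (γ.1 t)) p (lebIcc a b)).toReal +
        (eLpNorm (fun t => q.1 (δ.1 t)) p (lebIcc a b)).toReal
      rw [← ENNReal.toReal_add hγ.eLpNorm_ne_top hδ.eLpNorm_ne_top]
      refine ENNReal.toReal_mono
        (ENNReal.add_ne_top.2 ⟨hγ.eLpNorm_ne_top, hδ.eLpNorm_ne_top⟩) ?_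
      refine le_trans (eLpNorm_mono_real (fun t => ?_))
        (eLpNorm_add_le hγ.aestronglyMeasurable hδ.aestronglyMeasurable Fact.out)
      rw [Real.norm_of_nonneg (apply_nonneg q.1 _)]
      exact map_add_le_add q.1 _ _)
    (fun c x => by
      obtain ⟨γ, rfl⟩ := LpSpace.mk_surjective x
      change (eLpNorm (fun t => q.1 (c • γ.1 t)) p (lebIcc a b)).toReal =
        ‖c‖ * (eLpNorm (fun t => q.1 (γ.1 t)) p (lebIcc a b)).toReal
      have : (fun t => q.1 (c • γ.1 t)) = ‖c‖ • fun t => q.1 (γ.1 t) := by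
        ext t
        simp [map_smul_eq_mul]
      rw [this, eLpNorm_const_smul, ENNReal.toReal_mul]
      simp)

theorem LpSpace.seminorm_mk [Fact (1 ≤ p)] (q : ContSeminorm E) (γ : CurlyLp p a b E) :
    LpSpace.seminorm q (LpSpace.mk γ) = (eLpNorm (fun t => q.1 (γ.1 t)) p (lebIcc a b)).toReal :=
  rfl

/-- The locally convex topology on `L^p([a,b],E)` defined by the seminorms `‖·‖_{L^p,q}`. -/
noncomputable instance [Fact (1 ≤ p)] : TopologicalSpace (LpSpace p a b E) :=
  SeminormFamily.moduleFilterBasis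
    (fun q : ContSeminorm E => LpSpace.seminorm (p := p) (a := a) (b := b) q) |>.topology

theorem LpSpace.withSeminorms [Fact (1 ≤ p)] :
    WithSeminorms (fun q : ContSeminorm E => LpSpace.seminorm (p := p) (a := a) (b := b) q) :=
  ⟨rfl⟩

instance [Fact (1 ≤ p)] : IsTopologicalAddGroup (LpSpace p a b E) :=
  LpSpace.withSeminorms.topologicalAddGroup

instance [Fact (1 ≤ p)] : ContinuousSMul ℝ (LpSpace p a b E) :=
  LpSpace.withSeminorms.continuousSMul

instance [Fact (1 ≤ p)] : LocallyConvexSpace ℝ (LpSpace p a b E) :=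
  LpSpace.withSeminorms.toLocallyConvexSpace

end Lebesgue

/-! ### Weak integrals and absolutely continuous functions -/

/-- `w` is the weak integral of `γ` with respect to `μ`. -/
def IsWeakIntegral {X : Type*} [MeasurableSpace X] {E : Type u} [AddCommGroup E] [Module ℝ E]
    [TopologicalSpace E] (γ : X → E) (μ : Measure X) (w : E) : Prop :=
  ∀ α : E →L[ℝ] ℝ, Integrable (fun t => α (γ t)) μ ∧ α w = ∫ t, α (γ t) ∂μ

/-- The left endpoint of `[a,b]`. -/
def leftEndpoint (a b : ℝ) [hab : Fact (a < b)] : Icc a b := ⟨a, le_rfl, hab.out.le⟩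

section AC

variable (p : ℝ≥0∞) (a b : ℝ) [Fact (a < b)] (E : Type u) [AddCommGroup E] [Module ℝ E]
  [TopologicalSpace E] [IsTopologicalAddGroup E] [ContinuousSMul ℝ E]

variable {p a b E} in
/-- `η(t) = η(a) + ∫_a^t γ(s) ds` for all `t ∈ [a,b]`, with a weak integral. -/
def IsPrimitiveOf (η : C(Icc a b, E)) (γ : CurlyLp p a b E) : Prop :=
  ∀ t : Icc a b, IsWeakIntegral γ.1 ((lebIcc a b).restrict (Iic t)) (η t - η (leftEndpoint a b))

variable {p a b E} in
theorem IsPrimitiveOf.add {η ζ : C(Icc a b, E)} {γ δ : CurlyLp p a b E}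
    (h : IsPrimitiveOf η γ) (h' : IsPrimitiveOf ζ δ) : IsPrimitiveOf (η + ζ) (γ + δ) := by
  intro t α
  obtain ⟨i1, e1⟩ := h t α
  obtain ⟨i2, e2⟩ := h' t α
  refine ⟨(i1.add i2).congr (ae_of_all _ fun s => by simp), ?_⟩
  have h3 := integral_add i1 i2
  simp only [Submodule.coe_add, Pi.add_apply, map_add, ContinuousMap.add_apply, map_sub] at *
  rw [h3, ← e1, ← e2]
  ring

variable {p a b E} in
theorem IsPrimitiveOf.smul {η : C(Icc a b, E)} {γ : CurlyLp p a b E} (c : ℝ)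
    (h : IsPrimitiveOf η γ) : IsPrimitiveOf (c • η) (c • γ) := by
  intro t α
  obtain ⟨i1, e1⟩ := h t α
  refine ⟨(i1.const_mul c).congr (ae_of_all _ fun s => by simp), ?_⟩
  have h3 := integral_const_mul (μ := (lebIcc a b).restrict (Iic t)) c (fun s => α (γ.1 s))
  simp only [SetLike.val_smul, Pi.smul_apply, map_smul, ContinuousMap.smul_apply, map_sub,
    smul_eq_mul] at *
  rw [h3, ← e1]
  ring

/-- The vector space of continuous functions `η : [a,b] → E` which are of the form
`η(t) = η(a) + ∫_a^t γ(s) ds` for some `γ ∈ ℒ^p([a,b],E)`. -/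
def acSubmodule : Submodule ℝ C(Icc a b, E) where
  carrier := {η | ∃ γ : CurlyLp p a b E, IsPrimitiveOf η γ}
  add_mem' := by
    rintro η ζ ⟨γ, h⟩ ⟨δ, h'⟩
    exact ⟨γ + δ, h.add h'⟩
  zero_mem' := ⟨0, fun t α => by simp⟩
  smul_mem' := by
    rintro c η ⟨γ, h⟩
    exact ⟨c • γ, h.smul c⟩

/-- `AC_{L^p}([a,b],E)` (a type of its own, so that it does not carry the topology of uniform
convergence). -/
def ACSpace : Type u := acSubmodule p a b E

instance : AddCommGroup (ACSpace p a b E) := inferInstanceAs (AddCommGroup (acSubmodule p a b E))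

instance : Module ℝ (ACSpace p a b E) := inferInstanceAs (Module ℝ (acSubmodule p a b E))

variable {p a b E}

instance : CoeFun (ACSpace p a b E) (fun _ => Icc a b → E) := ⟨fun η => η.1⟩

/-- The derivative `η' = [γ] ∈ L^p([a,b],E)` of `η`; for Hausdorff locally convex `E` it does not
depend on the choice of `γ`, see `ACSpace.deriv_eq`. -/
noncomputable def ACSpace.deriv (η : ACSpace p a b E) : LpSpace p a b E :=
  LpSpace.mk (Classical.choose η.2)

/-- The map `η ↦ (η(a), η')`. -/
noncomputable def ACSpace.toProd (η : ACSpace p a b E) : E × LpSpace p a b E :=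
  (η (leftEndpoint a b), η.deriv)

/-- The topology on `AC_{L^p}([a,b],E)` which `η ↦ (η(a), η')` induces from
`E × L^p([a,b],E)`. -/
noncomputable instance [Fact (1 ≤ p)] : TopologicalSpace (ACSpace p a b E) :=
  TopologicalSpace.induced ACSpace.toProd inferInstance

/-- The set `AC_{L^p}([a,b],V)` of those `η ∈ AC_{L^p}([a,b],E)` that take values in `V`. -/
def ACSpace.valuedIn (V : Set E) : Set (ACSpace p a b E) := {η | ∀ t, η t ∈ V}

section WellDefined

variable [T2Space E] [LocallyConvexSpace ℝ E]

/-- A Lusin measurable function which is scalarly zero almost everywhere is zero almost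
everywhere. -/
theorem LusinMeasurable.ae_eq_zero {γ : Icc a b → E} (hγ : LusinMeasurable γ (lebIcc a b))
    (h : ∀ α : E →L[ℝ] ℝ, ∀ᵐ t ∂(lebIcc a b), α (γ t) = 0) : ∀ᵐ t ∂(lebIcc a b), γ t = 0 := by
  obtain ⟨C, hC, hn⟩ := hγ univ isCompact_univ
  have key : ∀ n, (lebIcc a b) {t | t ∈ C n ∧ γ t ≠ 0} = 0 := by
    intro n
    have hsep : ∀ t : {t | t ∈ C n ∧ γ t ≠ 0}, ∃ α : E →L[ℝ] ℝ, α (γ t.1) ≠ 0 := fun t =>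
      SeparatingDual.exists_ne_zero t.2.2
    choose α hα using hsep
    refine measure_null_of_locally_null _ fun t ht => ?_
    refine ⟨{s | s ∈ C n ∧ γ s ≠ 0} ∩ {s | α ⟨t, ht⟩ (γ s) ≠ 0}, ?_, ?_⟩
    · refine Filter.inter_mem self_mem_nhdsWithin ?_
      have hc : ContinuousWithinAt γ {t | t ∈ C n ∧ γ t ≠ 0} t :=
        ((hC n).2.2 t ht.1).mono fun s hs => hs.1
      have hc' : ContinuousWithinAt (fun s => α ⟨t, ht⟩ (γ s)) {t | t ∈ C n ∧ γ t ≠ 0} t :=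
        (α ⟨t, ht⟩).continuous.continuousAt.comp_continuousWithinAt hc
      exact hc'.eventually_ne (hα ⟨t, ht⟩)
    · exact measure_mono_null inter_subset_right (ae_iff.1 (h (α ⟨t, ht⟩)))
  rw [ae_iff]
  refine measure_mono_null ?_ (measure_union_null hn (measure_iUnion_null key))
  intro t ht
  by_cases htC : t ∈ ⋃ n, C n
  · obtain ⟨n, hn⟩ := mem_iUnion.1 htC
    exact Or.inr (mem_iUnion.2 ⟨n, hn, ht⟩)
  · exact Or.inl ⟨mem_univ _, htC⟩

theorem ae_eq_zero_of_integral_Iic_eq_zero {f : Icc a b → ℝ} (hf : Integrable f (lebIcc a b))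
    (h : ∀ t : Icc a b, ∫ s in Iic t, f s ∂(lebIcc a b) = 0) : ∀ᵐ t ∂(lebIcc a b), f t = 0 := by
  have hset : ∀ s : Set (Icc a b), MeasurableSet s → ∫ x in s, f x ∂(lebIcc a b) = 0 := by
    have : Fact (a ≤ b) := ⟨(Fact.out : a < b).le⟩
    have huniv : ∫ x, f x ∂(lebIcc a b) = 0 := by
      have h1 := h ⊤
      rwa [Iic_top, Measure.restrict_univ] at h1
    intro s hs
    induction s, hs using MeasurableSpace.induction_on_inter
      (borel_eq_generateFrom_Iic (Icc a b) ▸ BorelSpace.measurable_eq) isPiSystem_Iic with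
    | empty => simp
    | basic s hs =>
      obtain ⟨t, rfl⟩ := hs
      exact h t
    | compl s hs ih =>
      have := integral_add_compl hs hf
      linarith
    | iUnion g hd hm ih =>
      rw [integral_iUnion hm hd hf.integrableOn]
      simp [ih]
  exact hf.ae_eq_zero_of_forall_setIntegral_eq_zero fun s hs _ => hset s hs

/-- The derivative is uniquely determined almost everywhere. -/
theorem IsPrimitiveOf.mk_eq {η : C(Icc a b, E)} {γ δ : CurlyLp p a b E}
    (h : IsPrimitiveOf η γ) (h' : IsPrimitiveOf η δ) : LpSpace.mk γ = LpSpace.mk δ := by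
  rw [LpSpace.mk_eq_mk]
  have hz : ∀ᵐ t ∂(lebIcc a b), (γ - δ).1 t = 0 := by
    refine LusinMeasurable.ae_eq_zero (γ - δ).2.1 fun α => ?_
    have : Fact (a ≤ b) := ⟨(Fact.out : a < b).le⟩
    have ht := (h ⊤ α).1
    have ht' := (h' ⊤ α).1
    rw [Iic_top, Measure.restrict_univ] at ht ht'
    have hi : Integrable (fun t => α ((γ - δ).1 t)) (lebIcc a b) :=
      (ht.sub ht').congr (ae_of_all _ fun s => by simp)
    refine ae_eq_zero_of_integral_Iic_eq_zero hi fun t => ?_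
    have h3 := integral_sub (h t α).1 (h' t α).1
    rw [← (h t α).2, ← (h' t α).2, sub_self] at h3
    simpa using h3
  filter_upwards [hz] with t ht
  simpa [sub_eq_zero] using ht

theorem ACSpace.deriv_eq (η : ACSpace p a b E) {γ : CurlyLp p a b E}
    (h : IsPrimitiveOf η.1 γ) : η.deriv = LpSpace.mk γ :=
  (Classical.choose_spec η.2).mk_eq h

theorem ACSpace.deriv_add (η ζ : ACSpace p a b E) : (η + ζ).deriv = η.deriv + ζ.deriv :=
  ((η + ζ).deriv_eq ((Classical.choose_spec η.2).add (Classical.choose_spec ζ.2))).trans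
    (map_add _ _ _)

theorem ACSpace.deriv_smul (c : ℝ) (η : ACSpace p a b E) : (c • η).deriv = c • η.deriv :=
  ((c • η).deriv_eq ((Classical.choose_spec η.2).smul c)).trans (map_smul _ _ _)

/-- `η ↦ (η(a), η')` as a linear map. -/
noncomputable def ACSpace.toProdₗ : ACSpace p a b E →ₗ[ℝ] E × LpSpace p a b E where
  toFun := ACSpace.toProd
  map_add' η ζ := Prod.ext rfl (ACSpace.deriv_add η ζ)
  map_smul' c η := Prod.ext rfl (ACSpace.deriv_smul c η)

instance [Fact (1 ≤ p)] : IsTopologicalAddGroup (ACSpace p a b E) :=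
  topologicalAddGroup_induced ACSpace.toProdₗ

instance [Fact (1 ≤ p)] : ContinuousSMul ℝ (ACSpace p a b E) :=
  continuousSMul_induced ACSpace.toProdₗ

instance [Fact (1 ≤ p)] : LocallyConvexSpace ℝ (ACSpace p a b E) :=
  LocallyConvexSpace.induced ACSpace.toProdₗ

end WellDefined

end AC

/-! If `η` is a primitive of `γ`, then `f ∘ η` is a primitive of `t ↦ df (η t, γ t)`. In the
coordinates `(η(a), η')` the superposition operator therefore becomes `(f (η a), [df (η, γ)])`, and
everything reduces to seminorm estimates for `df` near the compact set `η([a,b])`.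

The chain rule `IsPrimitiveOf.comp` is tested against functionals `α`. Near the compact image, `α ∘
f` is Lipschitz for some continuous seminorm `r`, so increments of `α ∘ f ∘ η` are dominated by
those of the primitive of `r ∘ γ`, and `α ∘ f ∘ η` is absolutely continuous. A vector-valued
Lebesgue differentiation theorem for `r` (`IsPrimitiveOf.ae_tendsto`) identifies its derivative
almost everywhere, and the scalar fundamental theorem of calculus finishes.

Two orders of differentiability are lost because `df (x, y)` is linear in `y` but must be controlled
in `x`. The `C²` estimate `HasDirDerivOn.exists_lipschitz` gives continuity of the operator, and the
`C³` estimate `HasDirDerivOn.exists_taylor` gives its directional derivatives. Both bounds are at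
most linear in the directions, which are only `L^p` in `t`, while the displacement of the base point
is bounded uniformly in `t` by `ACSpace.exists_sup_bound`.

The directional derivative at `η` along `ζ` is `df ∘ (η, ζ)`: a superposition operator of the same
kind on `AC(E × E)`, precomposed with the continuous linear map `ACSpace.pair`. Induction on the
order yields `IsCnMapOn.acSpace_comp`. -/

/-! ### Continuous seminorms -/

section Seminorms

variable {E : Type*} [AddCommGroup E] [Module ℝ E] [TopologicalSpace E]
  [IsTopologicalAddGroup E] [ContinuousSMul ℝ E] [LocallyConvexSpace ℝ E]

theorem exists_contSeminorm_of_mem_nhds {x : E} {W : Set E} (hW : W ∈ 𝓝 x) :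
    ∃ r : ContSeminorm E, ∀ y, r.1 (y - x) < 1 → y ∈ W := by
  have h0 : (fun z => x + z) ⁻¹' W ∈ 𝓝 (0 : E) :=
    (continuous_const.add continuous_id).continuousAt.preimage_mem_nhds (by simpa using hW)
  obtain ⟨s, hs, hsW⟩ := (nhds_hasBasis_absConvex_open ℝ E).mem_iff.1 h0
  let S : AbsConvexOpenSets ℝ E := ⟨s, hs⟩
  refine ⟨⟨gaugeSeminormFamily ℝ E S, with_gaugeSeminormFamily.continuous_seminorm _⟩,
    fun y hy => ?_⟩
  have : y - x ∈ (gaugeSeminormFamily ℝ E S).ball 0 1 := by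
    rw [Seminorm.mem_ball_zero]
    exact hy
  rw [gaugeSeminormFamily_ball] at this
  simpa using hsW this

/-- Hahn–Banach applied to `c • x ↦ q x * c` on the line through `x`. Such norming functionals
reduce seminorm estimates for weak integrals and for curves to scalar ones. -/
theorem exists_dual_eq_contSeminorm (q : ContSeminorm E) (x : E) :
    ∃ α : E →L[ℝ] ℝ, α x = q.1 x ∧ ∀ y, |α y| ≤ q.1 y := by
  rcases eq_or_ne x 0 with rfl | hx
  · exact ⟨0, by simp, fun y => by simp⟩
  · let f : Module.Dual ℝ (ℝ ∙ x) :=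
      (q.1 x) • (LinearEquiv.toSpanNonzeroSingleton ℝ E x hx).symm.toLinearMap
    have hf : ∀ c : ℝ, ∀ h, f ⟨c • x, h⟩ = q.1 x * c := by
      intro c h
      have : (LinearEquiv.toSpanNonzeroSingleton ℝ E x hx).symm ⟨c • x, h⟩ = c := by
        rw [LinearEquiv.symm_apply_eq]
        rfl
      simp [f, this]
    obtain ⟨g, hg, hl⟩ := Module.Dual.exists_continuous_extension_of_le_seminorm_real
      (ℝ ∙ x) f q.2 (by
        rintro ⟨y, hy⟩
        obtain ⟨c, rfl⟩ := Submodule.mem_span_singleton.1 hy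
        rw [hf]
        simp only [map_smul_eq_mul, Real.norm_eq_abs]
        rw [mul_comm]
        exact mul_le_mul_of_nonneg_right (le_abs_self c) (apply_nonneg _ _))
    refine ⟨g, ?_, hl⟩
    have h1 := hg ⟨(1 : ℝ) • x, Submodule.mem_span_singleton.2 ⟨1, rfl⟩⟩
    rw [hf] at h1
    simpa using h1

theorem eq_of_forall_dual_eq [T2Space E] {x y : E} (h : ∀ α : E →L[ℝ] ℝ, α x = α y) : x = y := by
  by_contra hne
  obtain ⟨α, hα⟩ := SeparatingDual.exists_ne_zero (R := ℝ) (sub_ne_zero.2 hne)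
  exact hα (by simp [h α])

theorem tendsto_nhds_iff_contSeminorm {ι : Type*} {l : Filter ι} {u : ι → E} {x : E} :
    Tendsto u l (𝓝 x) ↔ ∀ q : ContSeminorm E, ∀ ε > 0, ∀ᶠ i in l, q.1 (u i - x) < ε :=
  (PolynormableSpace.withSeminorms ℝ E).tendsto_nhds u x

/-- A local property which persists when the seminorm is enlarged holds uniformly near a compact
set. -/
theorem IsCompact.exists_contSeminorm {K : Set E} (hK : IsCompact K)
    {Q : E → ContSeminorm E → Prop} (hmono : ∀ x r r', r ≤ r' → Q x r → Q x r')
    (hloc : ∀ x₀ ∈ K, ∃ r : ContSeminorm E, ∀ x, r.1 (x - x₀) < 1 → Q x r) :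
    ∃ r : ContSeminorm E, ∀ x₀ ∈ K, ∀ x, r.1 (x - x₀) < 1 → Q x r := by
  have : Nonempty (ContSeminorm E) := ⟨⟨0, continuous_const⟩⟩
  choose! ρ hρ using hloc
  -- The balls of radius `1/2` leave room for the triangle inequality; the factor `2` in the sum
  -- below makes its unit ball lie in each `ρ i`-ball of radius `1/2`.
  obtain ⟨t, htK, ht⟩ := hK.elim_nhds_subcover (fun x₀ => {x | (ρ x₀).1 (x - x₀) < 1 / 2})
    fun x₀ _ => by
      refine (isOpen_lt ((ρ x₀).2.comp (continuous_id.sub continuous_const))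
        continuous_const).mem_nhds ?_
      simp
  have hle : ∀ i ∈ t, ∀ z, 2 * (ρ i).1 z ≤ (∑ i ∈ t, (2 : NNReal) • (ρ i).1) z := by
    intro i hi z
    have h1 : (∑ i ∈ t, (2 : NNReal) • (ρ i).1) z = ∑ i ∈ t, 2 * (ρ i).1 z := by
      rw [← FunLike.coeAddMonoidHom_apply, map_sum, Finset.sum_apply]
      rfl
    rw [h1]
    exact Finset.single_le_sum (f := fun i => 2 * (ρ i).1 z)
      (fun i _ => mul_nonneg zero_le_two (apply_nonneg _ _)) hi
  refine ⟨⟨∑ i ∈ t, (2 : NNReal) • (ρ i).1, ?_⟩, fun x₀ hx₀ x hx => ?_⟩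
  · have h1 : ⇑(∑ i ∈ t, (2 : NNReal) • (ρ i).1) = fun z => ∑ i ∈ t, 2 * (ρ i).1 z := by
      ext z
      rw [← FunLike.coeAddMonoidHom_apply, map_sum, Finset.sum_apply]
      rfl
    rw [h1]
    exact continuous_finsetSum _ fun i _ => continuous_const.mul (ρ i).2
  · obtain ⟨i, hi, hxi⟩ := mem_iUnion₂.1 (ht hx₀)
    refine hmono x (ρ i) _ (fun z => ?_) (hρ i (htK i hi) x ?_)
    · have := hle i hi z
      have h0 := apply_nonneg (ρ i).1 z
      change (ρ i).1 z ≤ (∑ i ∈ t, (2 : NNReal) • (ρ i).1) z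
      linarith
    · have h1 := hle i hi (x - x₀)
      have h2 : (ρ i).1 (x - i) ≤ (ρ i).1 (x - x₀) + (ρ i).1 (x₀ - i) := by
        simpa using map_add_le_add (ρ i).1 (x - x₀) (x₀ - i)
      have h3 : (ρ i).1 (x₀ - i) < 1 / 2 := hxi
      have h4 : (∑ i ∈ t, (2 : NNReal) • (ρ i).1) (x - x₀) < 1 := hx
      linarith

variable {F : Type*} [AddCommGroup F] [Module ℝ F] [TopologicalSpace F]

/-- Continuity at `(x₀, 0)` bounds `T` by `1` for base points near `x₀` and small `y`; rescaling
each slot by homogeneity turns this into a product bound. Additivity in the slots plays no role. -/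
theorem exists_contSeminorm_le_prod {n : ℕ} (hn : n ≠ 0) {U : Set E} (hU : IsOpen U)
    {T : E × (Fin n → E) → F} (hT : ContinuousOn T (U ×ˢ univ))
    (hhom : ∀ x ∈ U, ∀ (y : Fin n → E) (c : Fin n → ℝ),
      T (x, fun i => c i • y i) = (∏ i, c i) • T (x, y))
    (q : ContSeminorm F) {x₀ : E} (hx₀ : x₀ ∈ U) :
    ∃ r : ContSeminorm E, ∀ x, r.1 (x - x₀) < 1 →
      x ∈ U ∧ ∀ y : Fin n → E, q.1 (T (x, y)) ≤ ∏ i, r.1 (y i) := by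
  have h0 : T (x₀, 0) = 0 := by
    have h := hhom x₀ hx₀ 0 0
    have h' : (∏ i : Fin n, (0 : Fin n → ℝ) i) = 0 := by simp [hn]
    rw [h', zero_smul] at h
    rw [← h]
    congr 2
    ext i
    simp
  have hc : ContinuousAt T (x₀, 0) :=
    hT.continuousAt ((hU.prod isOpen_univ).mem_nhds ⟨hx₀, mem_univ _⟩)
  have hN : {z : E × (Fin n → E) | z.1 ∈ U ∧ q.1 (T z) < 1} ∈ 𝓝 (x₀, (0 : Fin n → E)) := by
    refine Filter.inter_mem ((hU.preimage continuous_fst).mem_nhds hx₀) ?_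
    have h1 : ContinuousAt (fun z => q.1 (T z)) (x₀, 0) := q.2.continuousAt.comp hc
    exact h1.eventually_lt continuousAt_const (by simp [h0])
  obtain ⟨W₁, hW₁, W₂, hW₂, hW⟩ := mem_nhds_prod_iff.1 hN
  rw [nhds_pi, Filter.mem_pi'] at hW₂
  obtain ⟨I, t, ht, htW⟩ := hW₂
  obtain ⟨r₁, hr₁⟩ := exists_contSeminorm_of_mem_nhds hW₁
  obtain ⟨r₂, hr₂⟩ := exists_contSeminorm_of_mem_nhds
    (show (⋂ i, t i) ∈ 𝓝 (0 : E) from (Filter.iInter_mem.2 ht))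
  refine ⟨⟨r₁.1 + r₂.1, r₁.2.add r₂.2⟩, fun x hx => ?_⟩
  have hx : r₁.1 (x - x₀) + r₂.1 (x - x₀) < 1 := hx
  have hxW : x ∈ W₁ := hr₁ x (by linarith [apply_nonneg r₂.1 (x - x₀)])
  have key : ∀ y : Fin n → E, (∀ i, r₁.1 (y i) + r₂.1 (y i) < 1) → x ∈ U ∧ q.1 (T (x, y)) < 1 := by
    intro y hy
    refine hW (mk_mem_prod hxW (htW fun i _ => ?_))
    have h1 : y i ∈ ⋂ i, t i := hr₂ (y i) (by
      rw [sub_zero]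
      linarith [apply_nonneg r₁.1 (y i), hy i])
    exact mem_iInter.1 h1 i
  have hxU : x ∈ U := (key 0 fun i => by simp).1
  refine ⟨hxU, fun y => ?_⟩
  change q.1 (T (x, y)) ≤ ∏ i, (r₁.1 (y i) + r₂.1 (y i))
  set s : Fin n → ℝ := fun i => r₁.1 (y i) + r₂.1 (y i)
  have hs : ∀ i, 0 ≤ s i := fun i => add_nonneg (apply_nonneg _ _) (apply_nonneg _ _)
  -- Normalising by `s i + ε` rather than `s i` covers slots where the seminorm vanishes.
  have hε : ∀ ε > 0, q.1 (T (x, y)) ≤ ∏ i, (s i + ε) := by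
    intro ε hε
    have hpos : ∀ i, 0 < s i + ε := fun i => by linarith [hs i]
    have h1 := (key (fun i => (s i + ε)⁻¹ • y i) fun i => by
      rw [map_smul_eq_mul, map_smul_eq_mul, ← mul_add, Real.norm_of_nonneg (inv_pos.2 (hpos i)).le,
        inv_mul_lt_iff₀ (hpos i)]
      change s i < _
      linarith).2
    rw [hhom x hxU, map_smul_eq_mul, Finset.prod_inv_distrib,
      Real.norm_of_nonneg (inv_nonneg.2 (Finset.prod_nonneg fun i _ => (hpos i).le)),
      inv_mul_lt_iff₀ (Finset.prod_pos fun i _ => hpos i), mul_one] at h1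
    exact h1.le
  have hlim : Tendsto (fun ε : ℝ => ∏ i, (s i + ε)) (𝓝[>] 0) (𝓝 (∏ i, (s i + 0))) :=
    ((continuous_finsetProd _ fun i _ => continuous_const.add continuous_id).tendsto 0).mono_left
      nhdsWithin_le_nhds
  simp only [add_zero] at hlim
  exact ge_of_tendsto hlim (eventually_mem_nhdsWithin.mono hε)

end Seminorms

/-! ### Directional derivatives -/

/-- `df (x, y)` is the directional derivative of `f` at `x` in the direction `y`, for `x ∈ U`. -/
def HasDirDerivOn {E F : Type*} [AddCommGroup E] [Module ℝ E] [AddCommGroup F] [Module ℝ F]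
    [TopologicalSpace F] (f : E → F) (df : E × E → F) (U : Set E) : Prop :=
  ∀ x ∈ U, ∀ y : E,
    Tendsto (fun h : ℝ => h⁻¹ • (f (x + h • y) - f x)) (𝓝[≠] 0) (𝓝 (df (x, y)))

section Calculus

variable {E : Type*} [AddCommGroup E] [Module ℝ E] [TopologicalSpace E]
  [IsTopologicalAddGroup E] [ContinuousSMul ℝ E]
variable {F : Type*} [AddCommGroup F] [Module ℝ F] [TopologicalSpace F]
  [IsTopologicalAddGroup F] [ContinuousSMul ℝ F] [LocallyConvexSpace ℝ F]

theorem HasDirDerivOn.hasDerivAt {f : E → F} {df : E × E → F} {U : Set E}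
    (hf : HasDirDerivOn f df U) (α : F →L[ℝ] ℝ) {x y : E} {t : ℝ} (h : x + t • y ∈ U) :
    HasDerivAt (fun s : ℝ => α (f (x + s • y))) (α (df (x + t • y, y))) t := by
  rw [hasDerivAt_iff_tendsto_slope_zero]
  have h1 := (α.continuous.tendsto _).comp (hf _ h y)
  refine h1.congr fun s => ?_
  simp [add_smul, add_assoc]

/-- Mean value inequality for curves that are differentiable along functionals. -/
theorem contSeminorm_curve_sub_sub_le (q : ContSeminorm F) {c c' : ℝ → F} {w : F} {M : ℝ}
    (hc : ∀ α : F →L[ℝ] ℝ, ∀ u ∈ Icc (0 : ℝ) 1, HasDerivAt (fun s => α (c s)) (α (c' u)) u)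
    (hM : ∀ u ∈ Icc (0 : ℝ) 1, q.1 (c' u - w) ≤ M) : q.1 (c 1 - c 0 - w) ≤ M := by
  -- With `α` norming the vector to be estimated, the scalar mean value inequality applies to `α (c
  -- s) - s * α w`.
  obtain ⟨α, hα, hl⟩ := exists_dual_eq_contSeminorm q (c 1 - c 0 - w)
  have h := norm_image_sub_le_of_norm_deriv_le_segment_01' (f := fun s => α (c s) - s * α w)
    (f' := fun s => α (c' s) - 1 * α w) (C := M)
    (fun u hu => ((hc α u hu).sub ((hasDerivAt_id u).mul_const (α w))).hasDerivWithinAt)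
    (fun u hu => by
      have h1 := hl (c' u - w)
      rw [map_sub] at h1
      rw [one_mul, Real.norm_eq_abs]
      exact h1.trans (hM u ⟨hu.1, hu.2.le⟩))
  rw [← hα]
  refine (le_abs_self _).trans (le_trans (le_of_eq ?_) h)
  rw [Real.norm_eq_abs, map_sub, map_sub]
  congr 1
  ring

variable {f : E → F} {df : E × E → F} {U : Set E}

theorem HasDirDerivOn.contSeminorm_sub_sub_le (hf : HasDirDerivOn f df U) (q : ContSeminorm F)
    {x z : E} {w : F} {M : ℝ} (hU : ∀ u ∈ Icc (0 : ℝ) 1, x + u • z ∈ U)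
    (hM : ∀ u ∈ Icc (0 : ℝ) 1, q.1 (df (x + u • z, z) - w) ≤ M) :
    q.1 (f (x + z) - f x - w) ≤ M := by
  have h := contSeminorm_curve_sub_sub_le q (c := fun s => f (x + s • z))
    (c' := fun u => df (x + u • z, z)) (w := w) (M := M)
    (fun α u hu => hf.hasDerivAt α (hU u hu)) hM
  simpa using h

theorem HasDirDerivOn.smul [T2Space F] (hf : HasDirDerivOn f df U) {x : E} (hx : x ∈ U) (y : E)
    (c : ℝ) : df (x, c • y) = c • df (x, y) := by
  refine eq_of_forall_dual_eq fun α => ?_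
  have h1 := hf.hasDerivAt α (x := x) (y := c • y) (t := 0) (by simpa using hx)
  -- The point is written `0 * c` to match the value at `0` of the inner map `s ↦ s * c` in the
  -- chain rule.
  have h2 := hf.hasDerivAt α (x := x) (y := y) (t := 0 * c) (by simpa using hx)
  have h3 := HasDerivAt.comp (0 : ℝ) h2 ((hasDerivAt_id (0 : ℝ)).mul_const c)
  have h4 : (fun s : ℝ => α (f (x + s • c • y))) =
      (fun s : ℝ => α (f (x + s • y))) ∘ fun s => id s * c := by
    ext s
    simp [smul_smul]
  rw [h4] at h1
  have h5 := h1.unique h3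
  simpa [mul_comm] using h5

/-- Provides the uniformity in the segment parameters that the mean value inequality requires. -/
theorem eventually_forall_segment {p : ℝ × ℝ → Prop} (h : ∀ᶠ s in 𝓝 (0, 0), p s) :
    ∀ᶠ h : ℝ in 𝓝[≠] 0, ∀ v ∈ Icc (0 : ℝ) 1, ∀ u ∈ Icc (0 : ℝ) 1, p (v * h, u * h) := by
  rw [Metric.eventually_nhds_iff] at h
  obtain ⟨δ, hδ, hN⟩ := h
  have hev : ∀ᶠ h : ℝ in 𝓝[≠] 0, |h| < δ := nhdsWithin_le_nhds
    ((continuous_abs.tendsto' (0 : ℝ) 0 abs_zero).eventually (gt_mem_nhds hδ))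
  filter_upwards [hev] with h hh v hv u hu
  refine hN ?_
  rw [Prod.dist_eq, Real.dist_eq, Real.dist_eq, sub_zero, sub_zero, abs_mul, abs_mul,
    abs_of_nonneg hu.1, abs_of_nonneg hv.1]
  exact max_lt (lt_of_le_of_lt (mul_le_of_le_one_left (abs_nonneg h) hv.2) hh)
    (lt_of_le_of_lt (mul_le_of_le_one_left (abs_nonneg h) hu.2) hh)

/-- The base point of the quotient moves with `h`. The mean value inequality bounds the error by the
oscillation of `df (·, z)` near `x`, which tends to zero by continuity. Telescoping through `x + h •
y` then gives additivity of `df (x, ·)`. -/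
theorem HasDirDerivOn.tendsto_add (hU : IsOpen U) (hf : HasDirDerivOn f df U)
    (hc : ContinuousOn df (U ×ˢ univ)) [T2Space F] {x : E} (hx : x ∈ U) (y z : E) :
    Tendsto (fun h : ℝ => h⁻¹ • (f (x + h • y + h • z) - f (x + h • y))) (𝓝[≠] 0)
      (𝓝 (df (x, z))) := by
  rw [tendsto_nhds_iff_contSeminorm]
  intro q ε hε
  have hcz : ContinuousAt (fun s : ℝ × ℝ => df (x + s.1 • y + s.2 • z, z)) (0, 0) := by
    refine ContinuousAt.comp (g := df) (f := fun s : ℝ × ℝ => (x + s.1 • y + s.2 • z, z)) ?_ ?_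
    · exact hc.continuousAt ((hU.prod isOpen_univ).mem_nhds ⟨by simpa using hx, mem_univ _⟩)
    · exact Continuous.continuousAt (by fun_prop)
  have hN : ∀ᶠ s : ℝ × ℝ in 𝓝 (0, 0), x + s.1 • y + s.2 • z ∈ U ∧
      q.1 (df (x + s.1 • y + s.2 • z, z) - df (x, z)) < ε / 2 := by
    refine Filter.Eventually.and ?_ ?_
    · have : Continuous fun s : ℝ × ℝ => x + s.1 • y + s.2 • z := by fun_prop
      exact this.continuousAt.eventually (hU.mem_nhds (by simpa using hx))
    · have h1 := tendsto_nhds_iff_contSeminorm.1 hcz.tendsto q (ε / 2) (half_pos hε)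
      simpa using h1
  have hM := (eventually_forall_segment hN).mono fun h hh => hh 1 ⟨zero_le_one, le_rfl⟩
  simp only [one_mul] at hM
  filter_upwards [hM, eventually_mem_nhdsWithin] with h hh hne
  have hne : h ≠ 0 := hne
  have h3 := hf.contSeminorm_sub_sub_le q (x := x + h • y) (z := h • z) (w := h • df (x, z))
    (M := |h| * (ε / 2)) (fun u hu => by simpa [smul_smul] using (hh u hu).1) (fun u hu => by
      have h4 := hh u hu
      rw [smul_smul, hf.smul h4.1, ← smul_sub, map_smul_eq_mul, Real.norm_eq_abs]
      exact mul_le_mul_of_nonneg_left h4.2.le (abs_nonneg h))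
  have h5 : h⁻¹ • (f (x + h • y + h • z) - f (x + h • y)) - df (x, z) =
      h⁻¹ • (f (x + h • y + h • z) - f (x + h • y) - h • df (x, z)) := by
    rw [smul_sub h⁻¹ _ (h • _), inv_smul_smul₀ hne]
  rw [h5, map_smul_eq_mul, Real.norm_eq_abs, abs_inv]
  refine lt_of_le_of_lt (mul_le_mul_of_nonneg_left h3 (by positivity)) ?_
  rw [inv_mul_cancel_left₀ (abs_ne_zero.2 hne)]
  exact half_lt_self hε

theorem HasDirDerivOn.add [T2Space F] (hU : IsOpen U) (hf : HasDirDerivOn f df U)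
    (hc : ContinuousOn df (U ×ˢ univ)) {x : E} (hx : x ∈ U) (y z : E) :
    df (x, y + z) = df (x, y) + df (x, z) := by
  have h1 := (hf x hx y).add (hf.tendsto_add hU hc hx y z)
  refine tendsto_nhds_unique (hf x hx (y + z)) (h1.congr fun h => ?_)
  rw [← smul_add, smul_add h y z, ← add_assoc]
  congr 1
  abel

theorem HasDirDerivOn.sub [T2Space F] (hU : IsOpen U) (hf : HasDirDerivOn f df U)
    (hc : ContinuousOn df (U ×ˢ univ)) {x : E} (hx : x ∈ U) (y z : E) :
    df (x, y - z) = df (x, y) - df (x, z) := by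
  rw [eq_sub_iff_add_eq, ← hf.add hU hc hx, sub_add_cancel]

end Calculus

/-! ### Estimates for derivatives of order up to three -/

section HigherDerivatives

variable {E : Type*} [AddCommGroup E] [Module ℝ E] [TopologicalSpace E]
  [IsTopologicalAddGroup E] [ContinuousSMul ℝ E]
variable {F : Type*} [AddCommGroup F] [Module ℝ F] [TopologicalSpace F]
  [IsTopologicalAddGroup F] [ContinuousSMul ℝ F] [LocallyConvexSpace ℝ F] [T2Space F]
variable {f : E → F} {df : E × E → F} {d2f : (E × E) × (E × E) → F}
  {d3f : ((E × E) × (E × E)) × ((E × E) × (E × E)) → F} {U : Set E}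

/-- Carries homogeneity in directions already used over to the next derivative. -/
theorem HasDirDerivOn.eq_smul (hU : IsOpen U) {g₁ g₂ : E → F} {d₁ d₂ : E × E → F}
    (h₁ : HasDirDerivOn g₁ d₁ U) (h₂ : HasDirDerivOn g₂ d₂ U) {c : ℝ}
    (h : ∀ x ∈ U, g₁ x = c • g₂ x) {x : E} (hx : x ∈ U) (y : E) :
    d₁ (x, y) = c • d₂ (x, y) := by
  refine tendsto_nhds_unique (h₁ x hx y) (((h₂ x hx y).const_smul c).congr' ?_)
  have hev : ∀ᶠ t : ℝ in 𝓝[≠] 0, x + t • y ∈ U := nhdsWithin_le_nhds <|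
    (show Continuous fun t : ℝ => x + t • y by fun_prop).continuousAt.eventually
      (hU.mem_nhds (by simpa using hx))
  filter_upwards [hev] with t ht
  rw [h _ ht, h _ hx, ← smul_sub, smul_comm]

theorem HasDirDerivOn.fst (h2 : HasDirDerivOn df d2f (U ×ˢ univ)) (y : E) :
    HasDirDerivOn (fun x => df (x, y)) (fun p => d2f ((p.1, y), (p.2, 0))) U := by
  intro x hx z
  simpa using h2 (x, y) ⟨hx, mem_univ _⟩ (z, 0)

/-- Since `df (x, ·)` is linear, its difference quotient in direction `(0, w)` is constantly `df (x,
w)`; additivity of `d2f` in its direction does the rest. -/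
theorem HasDirDerivOn.deriv_linear (h1 : HasDirDerivOn f df U)
    (hU : IsOpen U) (hc1 : ContinuousOn df (U ×ˢ univ))
    (h2 : HasDirDerivOn df d2f (U ×ˢ univ)) (hc2 : ContinuousOn d2f ((U ×ˢ univ) ×ˢ univ))
    {x : E} (hx : x ∈ U) (y z w : E) :
    d2f ((x, y), (z, w)) = d2f ((x, y), (z, 0)) + df (x, w) := by
  have hxy : (x, y) ∈ U ×ˢ (univ : Set E) := ⟨hx, mem_univ _⟩
  have h3 : d2f ((x, y), (0, w)) = df (x, w) := by
    refine tendsto_nhds_unique (h2 (x, y) hxy (0, w))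
      (tendsto_const_nhds.congr' ?_)
    filter_upwards [eventually_mem_nhdsWithin] with h hh
    have hh : h ≠ 0 := hh
    simp only [Prod.smul_mk, smul_zero, Prod.mk_add_mk, add_zero]
    rw [h1.add hU hc1 hx, h1.smul hx, add_sub_cancel_left, inv_smul_smul₀ hh]
  rw [← h3, ← h2.add (hU.prod isOpen_univ) hc2 hxy]
  simp

/-- Schwarz's argument: the second difference is symmetric in `y` and `z`, so computing its limit in
either order shows that second derivatives commute. -/
theorem HasDirDerivOn.tendsto_second_difference (hU : IsOpen U) (h1 : HasDirDerivOn f df U)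
    (h2 : HasDirDerivOn df d2f (U ×ˢ univ)) (hc2 : ContinuousOn d2f ((U ×ˢ univ) ×ˢ univ))
    {x : E} (hx : x ∈ U) (y z : E) :
    Tendsto (fun s : ℝ => (s * s)⁻¹ • (f (x + s • y + s • z) - f (x + s • y) - (f (x + s • z) - f x)))
      (𝓝[≠] 0) (𝓝 (d2f ((x, z), (y, 0)))) := by
  rw [tendsto_nhds_iff_contSeminorm]
  intro q ε hε
  have hc : ContinuousAt (fun s : ℝ × ℝ => d2f ((x + s.1 • y + s.2 • z, z), (y, 0))) (0, 0) := by
    refine ContinuousAt.comp (g := d2f)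
      (f := fun s : ℝ × ℝ => ((x + s.1 • y + s.2 • z, z), (y, 0))) ?_ ?_
    · exact hc2.continuousAt (((hU.prod isOpen_univ).prod isOpen_univ).mem_nhds
        ⟨⟨by simpa using hx, mem_univ _⟩, mem_univ _⟩)
    · exact Continuous.continuousAt (by fun_prop)
  have hN : ∀ᶠ s : ℝ × ℝ in 𝓝 (0, 0), x + s.1 • y + s.2 • z ∈ U ∧
      q.1 (d2f ((x + s.1 • y + s.2 • z, z), (y, 0)) - d2f ((x, z), (y, 0))) < ε / 2 := by
    refine Filter.Eventually.and ?_ ?_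
    · have : Continuous fun s : ℝ × ℝ => x + s.1 • y + s.2 • z := by fun_prop
      exact this.continuousAt.eventually (hU.mem_nhds (by simpa using hx))
    · have h1 := tendsto_nhds_iff_contSeminorm.1 hc.tendsto q (ε / 2) (half_pos hε)
      simpa using h1
  filter_upwards [eventually_forall_segment hN, eventually_mem_nhdsWithin] with s hs hne
  have hne : s ≠ 0 := hne
  -- First mean value estimate: the map `df (·, z)` along `s • y`, which gains one factor `|s|`.
  have hin : ∀ u ∈ Icc (0 : ℝ) 1,
      q.1 (df (x + u • s • z + s • y, z) - df (x + u • s • z, z) - s • d2f ((x, z), (y, 0))) ≤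
        |s| * (ε / 2) := by
    intro u hu
    refine (h2.fst z).contSeminorm_sub_sub_le q (fun v hv => ?_) fun v hv => ?_
    · have := (hs v hv u hu).1
      simpa only [smul_smul, add_right_comm] using this
    · have h3 := hs v hv u hu
      have h4 : x + u • s • z + v • s • y = x + (v * s) • y + (u * s) • z := by
        rw [smul_smul, smul_smul, add_right_comm]
      rw [h4, show ((s • y, (0 : E)) : E × E) = s • (y, 0) by simp,
        h2.smul (x := (x + (v * s) • y + (u * s) • z, z)) ⟨h3.1, mem_univ _⟩, ← smul_sub, map_smul_eq_mul, Real.norm_eq_abs]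
      exact mul_le_mul_of_nonneg_left h3.2.le (abs_nonneg s)
  have h01 : (0 : ℝ) ∈ Icc (0 : ℝ) 1 := ⟨le_rfl, zero_le_one⟩
  have h11 : (1 : ℝ) ∈ Icc (0 : ℝ) 1 := ⟨zero_le_one, le_rfl⟩
  have hmem0 : ∀ u ∈ Icc (0 : ℝ) 1, x + u • s • z ∈ U := fun u hu => by
    simpa [smul_smul] using (hs 0 h01 u hu).1
  have hmem1 : ∀ u ∈ Icc (0 : ℝ) 1, x + s • y + u • s • z ∈ U := fun u hu => by
    simpa [smul_smul] using (hs 1 h11 u hu).1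
  -- Second mean value estimate: the difference of `f` along two parallel segments in direction `s •
  -- z`, which gains the other factor `|s|`.
  have hout := contSeminorm_curve_sub_sub_le q
    (c := fun u => f (x + s • y + u • s • z) - f (x + u • s • z))
    (c' := fun u => df (x + s • y + u • s • z, s • z) - df (x + u • s • z, s • z))
    (w := (s * s) • d2f ((x, z), (y, 0))) (M := |s| * (|s| * (ε / 2)))
    (fun α u hu => by
      simp only [map_sub]
      exact (h1.hasDerivAt α (hmem1 u hu)).sub (h1.hasDerivAt α (hmem0 u hu)))
    (fun u hu => by
      rw [h1.smul (hmem1 u hu), h1.smul (hmem0 u hu), ← smul_sub, mul_smul, ← smul_sub,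
        map_smul_eq_mul, Real.norm_eq_abs, add_right_comm]
      exact mul_le_mul_of_nonneg_left (hin u hu) (abs_nonneg s))
  simp only [one_smul, zero_smul, add_zero] at hout
  have hss : s * s ≠ 0 := mul_ne_zero hne hne
  have h5 : (s * s)⁻¹ • (f (x + s • y + s • z) - f (x + s • y) - (f (x + s • z) - f x)) -
      d2f ((x, z), (y, 0)) = (s * s)⁻¹ • (f (x + s • y + s • z) - f (x + s • z) -
        (f (x + s • y) - f x) - (s * s) • d2f ((x, z), (y, 0))) := by
    rw [smul_sub (s * s)⁻¹ _ ((s * s) • _), inv_smul_smul₀ hss]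
    congr 2
    abel
  rw [h5, map_smul_eq_mul, Real.norm_eq_abs, abs_inv, abs_mul]
  refine lt_of_le_of_lt (mul_le_mul_of_nonneg_left hout (by positivity)) ?_
  rw [← mul_assoc |s|, inv_mul_cancel_left₀ (mul_ne_zero (abs_ne_zero.2 hne) (abs_ne_zero.2 hne))]
  exact half_lt_self hε

/-- Symmetry of second directional derivatives. -/
theorem HasDirDerivOn.second_symm (hU : IsOpen U) (h1 : HasDirDerivOn f df U)
    (h2 : HasDirDerivOn df d2f (U ×ˢ univ)) (hc2 : ContinuousOn d2f ((U ×ˢ univ) ×ˢ univ))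
    {x : E} (hx : x ∈ U) (y z : E) : d2f ((x, z), (y, 0)) = d2f ((x, y), (z, 0)) := by
  refine tendsto_nhds_unique (h1.tendsto_second_difference hU h2 hc2 hx y z)
    ((h1.tendsto_second_difference hU h2 hc2 hx z y).congr fun s => ?_)
  rw [add_right_comm]
  congr 1
  abel

theorem HasDirDerivOn.second_smul (hU : IsOpen U) (h1 : HasDirDerivOn f df U)
    (h2 : HasDirDerivOn df d2f (U ×ˢ univ)) {x : E} (hx : x ∈ U) (y z : E) (c d : ℝ) :
    d2f ((x, c • y), (d • z, 0)) = (c * d) • d2f ((x, y), (z, 0)) := by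
  have h3 := (h2.fst (c • y)).eq_smul hU (h2.fst y) (c := c) (fun x hx => h1.smul hx y c) hx (d • z)
  have h4 := (h2.fst y).smul hx z d
  simp only at h3 h4
  rw [h3, h4, smul_smul]

theorem HasDirDerivOn.third_fst (h3 : HasDirDerivOn d2f d3f ((U ×ˢ univ) ×ˢ univ)) (y z : E) :
    HasDirDerivOn (fun x => d2f ((x, y), (z, 0)))
      (fun p => d3f (((p.1, y), (z, 0)), ((p.2, 0), 0))) U := by
  intro x hx v
  simpa using h3 ((x, y), (z, 0)) ⟨⟨hx, mem_univ _⟩, mem_univ _⟩ ((v, 0), 0)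

theorem HasDirDerivOn.third_smul (hU : IsOpen U) (h1 : HasDirDerivOn f df U)
    (h2 : HasDirDerivOn df d2f (U ×ˢ univ))
    (h3 : HasDirDerivOn d2f d3f ((U ×ˢ univ) ×ˢ univ)) {x : E} (hx : x ∈ U) (y z v : E)
    (c d e : ℝ) :
    d3f (((x, c • y), (d • z, 0)), ((e • v, 0), 0)) =
      (c * d * e) • d3f (((x, y), (z, 0)), ((v, 0), 0)) := by
  have h4 := (h3.third_fst (c • y) (d • z)).eq_smul hU (h3.third_fst y z) (c := c * d)
    (fun x hx => h1.second_smul hU h2 hx y z c d) hx (e • v)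
  have h5 := (h3.third_fst y z).smul hx v e
  simp only at h4 h5
  rw [h4, h5, smul_smul]

variable [LocallyConvexSpace ℝ E] {K : Set E}

theorem exists_contSeminorm_ge (r₁ r₂ : ContSeminorm E) :
    ∃ r : ContSeminorm E, (∀ x, r₁.1 x ≤ r.1 x) ∧ ∀ x, r₂.1 x ≤ r.1 x :=
  ⟨⟨r₁.1 + r₂.1, r₁.2.add r₂.2⟩, fun x => le_add_of_nonneg_right (apply_nonneg r₂.1 x),
    fun x => le_add_of_nonneg_left (apply_nonneg r₁.1 x)⟩

/-- Uniform bound for the first derivative near a compact set. -/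
theorem HasDirDerivOn.exists_bound (hU : IsOpen U) (h1 : HasDirDerivOn f df U)
    (hc1 : ContinuousOn df (U ×ˢ univ)) (hK : IsCompact K) (hKU : K ⊆ U) (q : ContSeminorm F) :
    ∃ r : ContSeminorm E, ∀ x₀ ∈ K, ∀ x, r.1 (x - x₀) < 1 →
      x ∈ U ∧ ∀ y, q.1 (df (x, y)) ≤ r.1 y := by
  refine hK.exists_contSeminorm (Q := fun x r => x ∈ U ∧ ∀ y, q.1 (df (x, y)) ≤ r.1 y)
    (fun x r r' hr h => ⟨h.1, fun y => (h.2 y).trans (hr y)⟩) fun x₀ hx₀ => ?_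
  obtain ⟨r, hr⟩ := exists_contSeminorm_le_prod (n := 1) one_ne_zero hU
    (T := fun p => df (p.1, p.2 0))
    (hc1.comp (by fun_prop) fun p hp => ⟨hp.1, mem_univ _⟩)
    (fun x hx y c => by simpa using h1.smul hx (y 0) (c 0)) q (hKU hx₀)
  exact ⟨r, fun x hx => ⟨(hr x hx).1, fun y => by simpa using (hr x hx).2 fun _ => y⟩⟩

theorem HasDirDerivOn.exists_bound_second (hU : IsOpen U) (h1 : HasDirDerivOn f df U)
    (h2 : HasDirDerivOn df d2f (U ×ˢ univ)) (hc2 : ContinuousOn d2f ((U ×ˢ univ) ×ˢ univ))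
    (hK : IsCompact K) (hKU : K ⊆ U) (q : ContSeminorm F) :
    ∃ r : ContSeminorm E, ∀ x₀ ∈ K, ∀ x, r.1 (x - x₀) < 1 →
      x ∈ U ∧ ∀ y z, q.1 (d2f ((x, y), (z, 0))) ≤ r.1 y * r.1 z := by
  refine hK.exists_contSeminorm
    (Q := fun x r => x ∈ U ∧ ∀ y z, q.1 (d2f ((x, y), (z, 0))) ≤ r.1 y * r.1 z)
    (fun x r r' hr h => ⟨h.1, fun y z => (h.2 y z).trans
      (mul_le_mul (hr y) (hr z) (apply_nonneg _ _) (apply_nonneg _ _))⟩) fun x₀ hx₀ => ?_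
  obtain ⟨r, hr⟩ := exists_contSeminorm_le_prod (n := 2) two_ne_zero hU
    (T := fun p => d2f ((p.1, p.2 0), (p.2 1, 0)))
    (hc2.comp (by fun_prop) fun p hp => ⟨⟨hp.1, mem_univ _⟩, mem_univ _⟩)
    (fun x hx y c => by
      simpa [Fin.prod_univ_two] using h1.second_smul hU h2 hx (y 0) (y 1) (c 0) (c 1)) q (hKU hx₀)
  exact ⟨r, fun x hx => ⟨(hr x hx).1, fun y z => by
    simpa [Fin.prod_univ_two] using (hr x hx).2 ![y, z]⟩⟩

theorem HasDirDerivOn.exists_bound_third (hU : IsOpen U) (h1 : HasDirDerivOn f df U)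
    (h2 : HasDirDerivOn df d2f (U ×ˢ univ))
    (h3 : HasDirDerivOn d2f d3f ((U ×ˢ univ) ×ˢ univ))
    (hc3 : ContinuousOn d3f (((U ×ˢ univ) ×ˢ univ) ×ˢ univ))
    (hK : IsCompact K) (hKU : K ⊆ U) (q : ContSeminorm F) :
    ∃ r : ContSeminorm E, ∀ x₀ ∈ K, ∀ x, r.1 (x - x₀) < 1 →
      x ∈ U ∧ ∀ y z v, q.1 (d3f (((x, y), (z, 0)), ((v, 0), 0))) ≤ r.1 y * r.1 z * r.1 v := by
  refine hK.exists_contSeminorm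
    (Q := fun x r => x ∈ U ∧ ∀ y z v, q.1 (d3f (((x, y), (z, 0)), ((v, 0), 0))) ≤
      r.1 y * r.1 z * r.1 v)
    (fun x r r' hr h => ⟨h.1, fun y z v => (h.2 y z v).trans (by
      have h0 := apply_nonneg r.1
      have h0' := apply_nonneg r'.1
      exact mul_le_mul (mul_le_mul (hr y) (hr z) (h0 _) (h0' _)) (hr v) (h0 _)
        (mul_nonneg (h0' _) (h0' _)))⟩) fun x₀ hx₀ => ?_
  obtain ⟨r, hr⟩ := exists_contSeminorm_le_prod (n := 3) three_ne_zero hU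
    (T := fun p => d3f (((p.1, p.2 0), (p.2 1, 0)), ((p.2 2, 0), 0)))
    (hc3.comp (by fun_prop) fun p hp => ⟨⟨⟨hp.1, mem_univ _⟩, mem_univ _⟩, mem_univ _⟩)
    (fun x hx y c => by
      simpa [Fin.prod_univ_three] using
        h1.third_smul hU h2 h3 hx (y 0) (y 1) (y 2) (c 0) (c 1) (c 2)) q (hKU hx₀)
  exact ⟨r, fun x hx => ⟨(hr x hx).1, fun y z v => by
    simpa [Fin.prod_univ_three] using (hr x hx).2 ![y, z, v]⟩⟩

theorem contSeminorm_smul_lt_one (r : ContSeminorm E) {z : E} (hz : r.1 z < 1) {u : ℝ}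
    (hu : u ∈ Icc (0 : ℝ) 1) (x : E) : r.1 (x + u • z - x) < 1 := by
  rw [add_sub_cancel_left, map_smul_eq_mul, Real.norm_of_nonneg hu.1]
  exact lt_of_le_of_lt (mul_le_of_le_one_left (apply_nonneg _ _) hu.2) hz

/-- Local Lipschitz estimate for the derivative of a `C²`-map. -/
theorem HasDirDerivOn.exists_lipschitz (hU : IsOpen U) (h1 : HasDirDerivOn f df U)
    (hc1 : ContinuousOn df (U ×ˢ univ))
    (h2 : HasDirDerivOn df d2f (U ×ˢ univ)) (hc2 : ContinuousOn d2f ((U ×ˢ univ) ×ˢ univ))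
    (hK : IsCompact K) (hKU : K ⊆ U) (q : ContSeminorm F) :
    ∃ r : ContSeminorm E, ∀ x ∈ K, ∀ z, r.1 z < 1 → x + z ∈ U ∧
      ∀ y y', q.1 (df (x + z, y') - df (x, y)) ≤ r.1 (y' - y) + r.1 z * r.1 y := by
  obtain ⟨r₁, hr₁⟩ := h1.exists_bound hU hc1 hK hKU q
  obtain ⟨r₂, hr₂⟩ := h1.exists_bound_second hU h2 hc2 hK hKU q
  obtain ⟨r, h1r, h2r⟩ := exists_contSeminorm_ge r₁ r₂
  refine ⟨r, fun x hx z hz => ?_⟩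
  have hb := hr₁ x hx (x + z) (by simpa using (h1r z).trans_lt hz)
  refine ⟨hb.1, fun y y' => ?_⟩
  have h3 : ∀ u ∈ Icc (0 : ℝ) 1, x + u • z ∈ U ∧ ∀ y v,
      q.1 (d2f ((x + u • z, y), (v, 0))) ≤ r₂.1 y * r₂.1 v := fun u hu =>
    hr₂ x hx _ (contSeminorm_smul_lt_one r₂ ((h2r z).trans_lt hz) hu x)
  have h4 := (h2.fst y).contSeminorm_sub_sub_le q (x := x) (z := z) (w := 0)
    (M := r.1 z * r.1 y) (fun u hu => (h3 u hu).1) (fun u hu => by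
      rw [sub_zero]
      refine ((h3 u hu).2 y z).trans ?_
      rw [mul_comm]
      exact mul_le_mul (h2r _) (h2r _) (apply_nonneg _ _) (apply_nonneg _ _))
  rw [sub_zero] at h4
  -- The change of direction is controlled by the bound on `df`, the change of base point by the
  -- bound on the second derivative.
  have h5 : df (x + z, y') - df (x, y) = df (x + z, y' - y) + (df (x + z, y) - df (x, y)) := by
    rw [h1.sub hU hc1 hb.1]
    abel
  rw [h5]
  exact (map_add_le_add q.1 _ _).trans (add_le_add ((hb.2 _).trans (h1r _)) h4)

/-- Taylor estimate for the derivative of a `C³`-map. -/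
theorem HasDirDerivOn.exists_taylor (hU : IsOpen U) (h1 : HasDirDerivOn f df U)
    (hc1 : ContinuousOn df (U ×ˢ univ))
    (h2 : HasDirDerivOn df d2f (U ×ˢ univ)) (hc2 : ContinuousOn d2f ((U ×ˢ univ) ×ˢ univ))
    (h3 : HasDirDerivOn d2f d3f ((U ×ˢ univ) ×ˢ univ))
    (hc3 : ContinuousOn d3f (((U ×ˢ univ) ×ˢ univ) ×ˢ univ))
    (hK : IsCompact K) (hKU : K ⊆ U) (q : ContSeminorm F) :
    ∃ r : ContSeminorm E, ∀ x ∈ K, ∀ (z : E) (h : ℝ), h ≠ 0 → r.1 (h • z) < 1 → x + h • z ∈ U ∧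
      ∀ y w, q.1 (h⁻¹ • (df (x + h • z, y + h • w) - df (x, y)) - d2f ((x, z), (y, w))) ≤
        |h| * (r.1 z * r.1 z) * r.1 y + |h| * r.1 z * r.1 w := by
  obtain ⟨r₁, hr₁⟩ := h1.exists_lipschitz hU hc1 h2 hc2 hK hKU q
  obtain ⟨r₂, hr₂⟩ := h1.exists_bound_third hU h2 h3 hc3 hK hKU q
  obtain ⟨r, h1r, h2r⟩ := exists_contSeminorm_ge r₁ r₂
  refine ⟨r, fun x hx z h hh hz => ?_⟩
  have hb := hr₁ x hx (h • z) ((h1r _).trans_lt hz)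
  refine ⟨hb.1, fun y w => ?_⟩
  have hxU := hKU hx
  have n0 : ∀ x, 0 ≤ r.1 x := apply_nonneg r.1
  have n2 : ∀ x, 0 ≤ r₂.1 x := apply_nonneg r₂.1
  have h4 : ∀ u ∈ Icc (0 : ℝ) 1, x + u • h • z ∈ U ∧ ∀ y v e,
      q.1 (d3f (((x + u • h • z, y), (v, 0)), ((e, 0), 0))) ≤ r₂.1 y * r₂.1 v * r₂.1 e :=
    fun u hu => hr₂ x hx _ (contSeminorm_smul_lt_one r₂ ((h2r _).trans_lt hz) hu x)
  have h5 : ∀ u ∈ Icc (0 : ℝ) 1, q.1 (d2f ((x + u • h • z, y), (z, 0)) - d2f ((x, y), (z, 0))) ≤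
      |h| * (r.1 z * r.1 z) * r.1 y := by
    intro u hu
    have h6 := (h3.third_fst y z).contSeminorm_sub_sub_le q (x := x) (z := u • h • z) (w := 0)
      (M := |h| * (r.1 z * r.1 z) * r.1 y) (fun v hv => by
        have := (h4 (v * u) ⟨mul_nonneg hv.1 hu.1, mul_le_one₀ hv.2 hu.1 hu.2⟩).1
        rwa [mul_smul] at this) (fun v hv => by
        have := (h4 (v * u) ⟨mul_nonneg hv.1 hu.1, mul_le_one₀ hv.2 hu.1 hu.2⟩).2
          y z (u • h • z)
        rw [mul_smul] at this
        rw [sub_zero]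
        refine this.trans ?_
        rw [map_smul_eq_mul, map_smul_eq_mul, Real.norm_of_nonneg hu.1, Real.norm_eq_abs]
        calc r₂.1 y * r₂.1 z * (u * (|h| * r₂.1 z))
            ≤ r.1 y * r.1 z * (1 * (|h| * r.1 z)) :=
              mul_le_mul (mul_le_mul (h2r _) (h2r _) (n2 _) (n0 _))
                (mul_le_mul hu.2 (mul_le_mul_of_nonneg_left (h2r _) (abs_nonneg _))
                  (mul_nonneg (abs_nonneg _) (n2 _)) zero_le_one)
                (mul_nonneg hu.1 (mul_nonneg (abs_nonneg _) (n2 _)))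
                (mul_nonneg (n0 _) (n0 _))
          _ = _ := by ring)
    simpa using h6
  have h7 := (h2.fst y).contSeminorm_sub_sub_le q (x := x) (z := h • z)
    (w := h • d2f ((x, y), (z, 0))) (M := |h| * (|h| * (r.1 z * r.1 z) * r.1 y))
    (fun u hu => (h4 u hu).1) (fun u hu => by
      have := (h2.fst y).smul (h4 u hu).1 z h
      simp only at this ⊢
      rw [this, ← smul_sub, map_smul_eq_mul, Real.norm_eq_abs]
      exact mul_le_mul_of_nonneg_left (h5 u hu) (abs_nonneg h))
  -- The term `d2f ((x, z), (y, w))` is what the chain rule yields for `df` along a pair of curves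
  -- through `(x, z)` with velocities `(y, w)`. By symmetry it equals `d2f ((x, y), (z, 0)) + df (x,
  -- w)`. This leaves a second-order remainder of `df (·, y)` and a Lipschitz increment of `df (·,
  -- w)`.
  have h8 : h⁻¹ • (df (x + h • z, y + h • w) - df (x, y)) - d2f ((x, z), (y, w)) =
      h⁻¹ • (df (x + h • z, y) - df (x, y) - h • d2f ((x, y), (z, 0))) +
        (df (x + h • z, w) - df (x, w)) := by
    rw [h1.add hU hc1 hb.1, h1.smul hb.1, h1.deriv_linear hU hc1 h2 hc2 hxU z y w,
      h1.second_symm hU h2 hc2 hxU y z, smul_sub h⁻¹ _ (h • d2f _), inv_smul_smul₀ hh,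
      add_sub_right_comm, smul_add, inv_smul_smul₀ hh]
    abel
  rw [h8]
  refine (map_add_le_add q.1 _ _).trans (add_le_add ?_ ?_)
  · rw [map_smul_eq_mul, norm_inv, Real.norm_eq_abs]
    rw [inv_mul_le_iff₀ (abs_pos.2 hh)]
    exact h7
  · refine (hb.2 w w).trans ?_
    rw [sub_self, map_zero, zero_add, map_smul_eq_mul, Real.norm_eq_abs]
    exact mul_le_mul (mul_le_mul_of_nonneg_left (h1r _) (abs_nonneg _)) (h1r _)
      (apply_nonneg _ _) (mul_nonneg (abs_nonneg _) (n0 _))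

end HigherDerivatives

/-! ### Seminorms on spaces of absolutely continuous functions -/

section ACBasics

variable {p : ℝ≥0∞} {a b : ℝ} {E : Type*} [AddCommGroup E] [Module ℝ E] [TopologicalSpace E]
  [IsTopologicalAddGroup E] [ContinuousSMul ℝ E]

theorem CurlyLp.integrable [Fact (1 ≤ p)] (γ : CurlyLp p a b E) (q : ContSeminorm E) :
    Integrable (fun t => q.1 (γ.1 t)) (lebIcc a b) :=
  (γ.2.2 q.1 q.2).integrable Fact.out

theorem exists_integral_le_seminorm (p : ℝ≥0∞) [Fact (1 ≤ p)] (a b : ℝ) :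
    ∃ C : ℝ, 0 ≤ C ∧ ∀ {E : Type u} [AddCommGroup E] [Module ℝ E] [TopologicalSpace E]
      [IsTopologicalAddGroup E] [ContinuousSMul ℝ E] (q : ContSeminorm E) (γ : CurlyLp p a b E),
      ∫ t, q.1 (γ.1 t) ∂(lebIcc a b) ≤ C * LpSpace.seminorm q (LpSpace.mk γ) := by
  -- The Hölder constant `λ([a,b])^(1 - 1/p)`. For `p = ∞` the conventions `∞.toReal = 0` and `1 / 0
  -- = 0` give the correct exponent `1`.
  refine ⟨(lebIcc a b univ ^ (1 / (1 : ℝ≥0∞).toReal - 1 / p.toReal)).toReal,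
    ENNReal.toReal_nonneg, fun q γ => ?_⟩
  have hm := γ.2.2 q.1 q.2
  have h1 : ∫ t, q.1 (γ.1 t) ∂(lebIcc a b) =
      (eLpNorm (fun t => q.1 (γ.1 t)) 1 (lebIcc a b)).toReal := by
    rw [eLpNorm_one_eq_lintegral_enorm, ← integral_norm_eq_lintegral_enorm hm.1]
    exact integral_congr_ae (ae_of_all _ fun t => (Real.norm_of_nonneg (apply_nonneg _ _)).symm)
  rw [h1, LpSpace.seminorm_mk, mul_comm, ← ENNReal.toReal_mul]
  have hp : (1 : ℝ≥0∞) ≤ p := Fact.out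
  have hexp : 0 ≤ 1 / (1 : ℝ≥0∞).toReal - 1 / p.toReal := by
    rcases eq_or_ne p ∞ with rfl | htop
    · simp
    · have : 1 ≤ p.toReal := by
        simpa using ENNReal.toReal_mono htop hp
      simp only [ENNReal.toReal_one, div_one, sub_nonneg]
      exact (div_le_one (by linarith)).2 this
  refine ENNReal.toReal_mono (ENNReal.mul_ne_top hm.eLpNorm_ne_top
    (ENNReal.rpow_ne_top_of_nonneg hexp (measure_ne_top _ _))) ?_
  exact eLpNorm_le_eLpNorm_mul_rpow_measure_univ hp hm.1

theorem IsWeakIntegral.contSeminorm_le [LocallyConvexSpace ℝ E] {X : Type*} [MeasurableSpace X]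
    {γ : X → E} {μ : Measure X} {w : E} (h : IsWeakIntegral γ μ w) (q : ContSeminorm E)
    (hi : Integrable (fun t => q.1 (γ t)) μ) : q.1 w ≤ ∫ t, q.1 (γ t) ∂μ := by
  obtain ⟨α, hα, hl⟩ := exists_dual_eq_contSeminorm q w
  rw [← hα, (h α).2]
  exact integral_mono (h α).1 hi fun t => (le_abs_self _).trans (hl _)

/-- Minkowski's inequality, in the two-term shape taken by the Lipschitz, Taylor and pairing
estimates. -/
theorem LpSpace.seminorm_mk_le [Fact (1 ≤ p)] {F : Type*} [AddCommGroup F] [Module ℝ F]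
    [TopologicalSpace F] [IsTopologicalAddGroup F] [ContinuousSMul ℝ F]
    {G : Type*} [AddCommGroup G] [Module ℝ G]
    [TopologicalSpace G] [IsTopologicalAddGroup G] [ContinuousSMul ℝ G]
    (q : ContSeminorm F) (r : ContSeminorm E) (s : ContSeminorm G) (δ : CurlyLp p a b F)
    (γ₁ : CurlyLp p a b E) (γ₂ : CurlyLp p a b G)
    {c₁ c₂ : ℝ} (hc₁ : 0 ≤ c₁) (hc₂ : 0 ≤ c₂)
    (h : ∀ᵐ t ∂(lebIcc a b), q.1 (δ.1 t) ≤ c₁ * r.1 (γ₁.1 t) + c₂ * s.1 (γ₂.1 t)) :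
    LpSpace.seminorm q (LpSpace.mk δ) ≤
      c₁ * LpSpace.seminorm r (LpSpace.mk γ₁) + c₂ * LpSpace.seminorm s (LpSpace.mk γ₂) := by
  have m₁ := (γ₁.2.2 r.1 r.2).const_mul c₁
  have m₂ := (γ₂.2.2 s.1 s.2).const_mul c₂
  have e : ∀ {c : ℝ} (_ : 0 ≤ c) (g : Icc a b → ℝ),
      c * (eLpNorm g p (lebIcc a b)).toReal =
        (eLpNorm (fun t => c * g t) p (lebIcc a b)).toReal := by
    intro c hc g
    have h1 := eLpNorm_const_smul c g p (lebIcc a b)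
    have h2 : (c • g) = fun t => c * g t := rfl
    rw [h2] at h1
    rw [h1, ENNReal.toReal_mul]
    simp [abs_of_nonneg hc]
  rw [LpSpace.seminorm_mk, LpSpace.seminorm_mk, LpSpace.seminorm_mk, e hc₁, e hc₂,
    ← ENNReal.toReal_add m₁.eLpNorm_ne_top m₂.eLpNorm_ne_top]
  refine ENNReal.toReal_mono (ENNReal.add_ne_top.2 ⟨m₁.eLpNorm_ne_top, m₂.eLpNorm_ne_top⟩) ?_
  refine le_trans (eLpNorm_mono_ae_real (h.mono fun t ht => ?_)) (eLpNorm_add_le m₁.1 m₂.1 Fact.out)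
  rw [Real.norm_of_nonneg (apply_nonneg _ _)]
  exact ht

variable [Fact (a < b)]

theorem IsPrimitiveOf.sub_Ioc {η : C(Icc a b, E)} {γ : CurlyLp p a b E}
    (h : IsPrimitiveOf η γ) {s t : Icc a b} (hst : s ≤ t) :
    IsWeakIntegral γ.1 ((lebIcc a b).restrict (Ioc s t)) (η t - η s) := by
  intro α
  obtain ⟨it, et⟩ := h t α
  obtain ⟨is, es⟩ := h s α
  have hsub : Ioc s t ⊆ Iic t := Ioc_subset_Iic_self
  have hi : IntegrableOn (fun t => α (γ.1 t)) (Ioc s t) (lebIcc a b) :=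
    IntegrableOn.mono_set (t := Iic t) it hsub
  refine ⟨hi, ?_⟩
  have h1 : Iic t = Iic s ∪ Ioc s t := (Iic_union_Ioc_eq_Iic hst).symm
  have h2 : Disjoint (Iic s) (Ioc s t) := (Iic_disjoint_Ioc le_rfl)
  rw [h1, setIntegral_union h2 measurableSet_Ioc is hi] at et
  rw [map_sub] at *
  linarith

variable [Fact (1 ≤ p)] [T2Space E] [LocallyConvexSpace ℝ E]

theorem ACSpace.exists_primitive (η : ACSpace p a b E) :
    ∃ γ : CurlyLp p a b E, IsPrimitiveOf η.1 γ ∧ η.deriv = LpSpace.mk γ :=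
  ⟨Classical.choose η.2, Classical.choose_spec η.2, rfl⟩

/-- The continuous seminorm `η ↦ q (η a) + ‖η'‖_{L^p,q}` on `AC_{L^p}([a,b],E)`. -/
noncomputable def ACSpace.seminorm (q : ContSeminorm E) : Seminorm ℝ (ACSpace p a b E) :=
  (q.1.comp (LinearMap.fst ℝ E (LpSpace p a b E)) +
    (LpSpace.seminorm q).comp (LinearMap.snd ℝ E (LpSpace p a b E))).comp ACSpace.toProdₗ

theorem ACSpace.seminorm_apply (q : ContSeminorm E) (η : ACSpace p a b E) :
    ACSpace.seminorm q η = q.1 (η (leftEndpoint a b)) + LpSpace.seminorm q η.deriv := rfl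

theorem ACSpace.continuous_toProd : Continuous (ACSpace.toProd : ACSpace p a b E → _) :=
  continuous_induced_dom

theorem ACSpace.continuous_seminorm (q : ContSeminorm E) :
    Continuous (ACSpace.seminorm q : Seminorm ℝ (ACSpace p a b E)) :=
  (q.2.comp (continuous_fst.comp ACSpace.continuous_toProd)).add
    ((LpSpace.withSeminorms.continuous_seminorm q).comp
      (continuous_snd.comp ACSpace.continuous_toProd))

theorem ACSpace.tendsto_nhds {ι : Type*} {l : Filter ι} {u : ι → ACSpace p a b E}
    {η : ACSpace p a b E}
    (h : ∀ q : ContSeminorm E, ∀ ε > 0, ∀ᶠ i in l, ACSpace.seminorm q (u i - η) < ε) :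
    Tendsto u l (𝓝 η) := by
  rw [nhds_induced, tendsto_comap_iff, ACSpace.toProd, nhds_prod_eq]
  have hsub : ∀ i, (u i - η).deriv = (u i).deriv - η.deriv := fun i =>
    congrArg Prod.snd (map_sub (ACSpace.toProdₗ (p := p) (a := a) (b := b) (E := E)) (u i) η)
  refine Tendsto.prodMk (tendsto_nhds_iff_contSeminorm.2 fun q ε hε => ?_)
    ((LpSpace.withSeminorms.tendsto_nhds _ _).2 fun q ε hε => ?_)
  · filter_upwards [h q ε hε] with i hi
    rw [ACSpace.seminorm_apply] at hi
    exact (le_add_of_nonneg_right (apply_nonneg _ _)).trans_lt hi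
  · filter_upwards [h q ε hε] with i hi
    rw [ACSpace.seminorm_apply, hsub] at hi
    exact (le_add_of_nonneg_left (apply_nonneg _ _)).trans_lt hi

/-- From `η t = η a + ∫ γ` and the embedding of `L^p` into `L¹`: the topology of `AC` is finer than
uniform convergence. -/
theorem ACSpace.exists_sup_bound (p : ℝ≥0∞) [Fact (1 ≤ p)] (a b : ℝ) [Fact (a < b)]
    (E : Type*) [AddCommGroup E] [Module ℝ E] [TopologicalSpace E]
    [IsTopologicalAddGroup E] [ContinuousSMul ℝ E] [T2Space E] [LocallyConvexSpace ℝ E] :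
    ∃ C : ℝ, 0 ≤ C ∧ ∀ (q : ContSeminorm E) (η : ACSpace p a b E) (t : Icc a b),
      q.1 (η t) ≤ C * ACSpace.seminorm q η := by
  obtain ⟨C, hC, hb⟩ := exists_integral_le_seminorm p a b
  refine ⟨1 + C, by linarith, fun q η t => ?_⟩
  obtain ⟨γ, hγ, hd⟩ := η.exists_primitive
  rw [ACSpace.seminorm_apply, hd]
  have h1 := (hγ t).contSeminorm_le q (CurlyLp.integrable γ q).integrableOn
  have h2 : ∫ s in Iic t, q.1 (γ.1 s) ∂(lebIcc a b) ≤ ∫ s, q.1 (γ.1 s) ∂(lebIcc a b) :=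
    setIntegral_le_integral (CurlyLp.integrable γ q) (ae_of_all _ fun s => apply_nonneg _ _)
  have h3 := hb q γ
  have h4 : q.1 (η t) ≤ q.1 (η.1 t - η.1 (leftEndpoint a b)) + q.1 (η (leftEndpoint a b)) := by
    simpa using map_add_le_add q.1 (η.1 t - η.1 (leftEndpoint a b)) (η (leftEndpoint a b))
  have h5 := apply_nonneg q.1 (η (leftEndpoint a b))
  have h6 := apply_nonneg (LpSpace.seminorm q) (LpSpace.mk γ)
  nlinarith [mul_nonneg hC h5]

theorem ACSpace.isOpen_valuedIn {V : Set E} (hV : IsOpen V) :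
    IsOpen (ACSpace.valuedIn V : Set (ACSpace p a b E)) := by
  rw [isOpen_iff_mem_nhds]
  intro η hη
  obtain ⟨C, hC, hb⟩ := ACSpace.exists_sup_bound p a b E
  -- A single seminorm `r` keeps the `r`-unit balls around all points of the compact image inside
  -- `V`.
  obtain ⟨r, hr⟩ := (isCompact_range η.1.continuous).exists_contSeminorm
    (Q := fun x _ => x ∈ V) (fun _ _ _ _ h => h) (by
      rintro _ ⟨t, rfl⟩
      exact exists_contSeminorm_of_mem_nhds (hV.mem_nhds (hη t)))
  have hc : Continuous fun ζ : ACSpace p a b E => C * ACSpace.seminorm r (ζ - η) :=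
    continuous_const.mul ((ACSpace.continuous_seminorm r).comp (continuous_id.sub continuous_const))
  filter_upwards [(isOpen_lt hc continuous_const).mem_nhds
    (show C * ACSpace.seminorm r (η - η) < 1 by simp)] with ζ hζ t
  exact hr _ ⟨t, rfl⟩ _ ((hb r (ζ - η) t).trans_lt hζ)

end ACBasics

/-! ### Pairs of absolutely continuous functions -/

section Pair

variable {p : ℝ≥0∞} {a b : ℝ} {E : Type u} [AddCommGroup E] [Module ℝ E] [TopologicalSpace E]
  [IsTopologicalAddGroup E] [ContinuousSMul ℝ E]
  {G : Type v} [AddCommGroup G] [Module ℝ G] [TopologicalSpace G]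
  [IsTopologicalAddGroup G] [ContinuousSMul ℝ G]

/-- The restriction of a continuous seminorm on a product to the first factor. -/
def ContSeminorm.inl (q : ContSeminorm (E × G)) : ContSeminorm E :=
  ⟨q.1.comp (LinearMap.inl ℝ E G), q.2.comp (continuous_id.prodMk continuous_const)⟩

/-- The restriction of a continuous seminorm on a product to the second factor. -/
def ContSeminorm.inr (q : ContSeminorm (E × G)) : ContSeminorm G :=
  ⟨q.1.comp (LinearMap.inr ℝ E G), q.2.comp (continuous_const.prodMk continuous_id)⟩

theorem ContSeminorm.le_inl_add_inr (q : ContSeminorm (E × G)) (x : E) (y : G) :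
    q.1 (x, y) ≤ (ContSeminorm.inl q).1 x + (ContSeminorm.inr q).1 y := by
  have h := map_add_le_add q.1 (x, (0 : G)) (0, y)
  rw [Prod.mk_add_mk, add_zero, zero_add] at h
  exact h

/-- Pairs of `ℒ^p`-functions. -/
def CurlyLp.pair (γ : CurlyLp p a b E) (δ : CurlyLp p a b G) : CurlyLp p a b (E × G) :=
  ⟨fun t => (γ.1 t, δ.1 t), γ.2.1.prodMk δ.2.1, fun q hq => by
    refine ((γ.2.2 _ (ContSeminorm.inl ⟨q, hq⟩).2).add (δ.2.2 _ (ContSeminorm.inr ⟨q, hq⟩).2)).mono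
      ((γ.2.1.prodMk δ.2.1).comp_continuous hq).aestronglyMeasurable (ae_of_all _ fun t => ?_)
    rw [Real.norm_of_nonneg (apply_nonneg _ _)]
    exact (ContSeminorm.le_inl_add_inr ⟨q, hq⟩ _ _).trans (le_abs_self _)⟩

variable [Fact (a < b)]

theorem IsPrimitiveOf.pair {η : C(Icc a b, E)} {ζ : C(Icc a b, G)} {γ : CurlyLp p a b E}
    {δ : CurlyLp p a b G} (h : IsPrimitiveOf η γ) (h' : IsPrimitiveOf ζ δ) :
    IsPrimitiveOf (η.prodMk ζ) (CurlyLp.pair γ δ) := by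
  intro t α
  obtain ⟨i1, e1⟩ := h t (α.comp (ContinuousLinearMap.inl ℝ E G))
  obtain ⟨i2, e2⟩ := h' t (α.comp (ContinuousLinearMap.inr ℝ E G))
  have key : ∀ x y, α (x, y) = α.comp (ContinuousLinearMap.inl ℝ E G) x +
      α.comp (ContinuousLinearMap.inr ℝ E G) y := by
    intro x y
    simp [← map_add]
  refine ⟨(i1.add i2).congr (ae_of_all _ fun s => (key _ _).symm), ?_⟩
  have h3 := integral_add i1 i2
  rw [← e1, ← e2] at h3
  refine Eq.trans (key _ _) (h3.symm.trans (integral_congr_ae (ae_of_all _ fun s => ?_)))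
  exact (key _ _).symm

/-- The identification `AC(E) × AC(G) → AC(E × G)`. -/
def ACSpace.pair : ACSpace p a b E × ACSpace p a b G →ₗ[ℝ] ACSpace p a b (E × G) where
  toFun ηζ := ⟨ηζ.1.1.prodMk ηζ.2.1, by
    obtain ⟨γ, hγ⟩ := ηζ.1.2
    obtain ⟨δ, hδ⟩ := ηζ.2.2
    exact ⟨CurlyLp.pair γ δ, hγ.pair hδ⟩⟩
  map_add' _ _ := rfl
  map_smul' _ _ := rfl

variable [Fact (1 ≤ p)] [T2Space E] [LocallyConvexSpace ℝ E] [T2Space G] [LocallyConvexSpace ℝ G]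

theorem ACSpace.seminorm_pair_le (q : ContSeminorm (E × G)) (η : ACSpace p a b E)
    (ζ : ACSpace p a b G) :
    ACSpace.seminorm q (ACSpace.pair (η, ζ)) ≤
      ACSpace.seminorm (ContSeminorm.inl q) η + ACSpace.seminorm (ContSeminorm.inr q) ζ := by
  obtain ⟨γ, hγ, eγ⟩ := η.exists_primitive
  obtain ⟨δ, hδ, eδ⟩ := ζ.exists_primitive
  rw [ACSpace.seminorm_apply, ACSpace.seminorm_apply, ACSpace.seminorm_apply, eγ, eδ,
    (ACSpace.pair (η, ζ)).deriv_eq (hγ.pair hδ)]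
  have h1 := LpSpace.seminorm_mk_le q (ContSeminorm.inl q) (ContSeminorm.inr q) (CurlyLp.pair γ δ) γ δ
    zero_le_one zero_le_one (ae_of_all _ fun t => by
      rw [one_mul, one_mul]
      exact ContSeminorm.le_inl_add_inr q (γ.1 t) (δ.1 t))
  have h2 := ContSeminorm.le_inl_add_inr q (η (leftEndpoint a b)) (ζ (leftEndpoint a b))
  have h3 : (ACSpace.pair (η, ζ)) (leftEndpoint a b) =
    (η (leftEndpoint a b), ζ (leftEndpoint a b)) := rfl
  rw [h3]
  linarith

/-- Needed to pull superposition with `df` back from `AC(E × G)` to a product of two `AC` spaces. -/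
theorem ACSpace.continuous_pair :
    Continuous (ACSpace.pair : ACSpace p a b E × ACSpace p a b G →ₗ[ℝ] ACSpace p a b (E × G)) := by
  refine continuous_iff_continuousAt.2 fun x => ACSpace.tendsto_nhds fun q ε hε => ?_
  have hc : Continuous fun y : ACSpace p a b E × ACSpace p a b G =>
      ACSpace.seminorm (ContSeminorm.inl q) (y.1 - x.1) +
        ACSpace.seminorm (ContSeminorm.inr q) (y.2 - x.2) :=
    ((ACSpace.continuous_seminorm _).comp (continuous_fst.sub continuous_const)).add
      ((ACSpace.continuous_seminorm _).comp (continuous_snd.sub continuous_const))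
  have hlt : ∀ᶠ y in 𝓝 x, ACSpace.seminorm (ContSeminorm.inl q) (y.1 - x.1) +
      ACSpace.seminorm (ContSeminorm.inr q) (y.2 - x.2) < ε :=
    hc.continuousAt.eventually_lt continuousAt_const (by simpa using hε)
  filter_upwards [hlt] with y hy
  rw [← map_sub]
  exact (ACSpace.seminorm_pair_le q _ _).trans_lt hy

end Pair

/-! ### Lebesgue measure on `[a,b]` and interval integrals -/

section Transfer

variable {a b : ℝ}

theorem map_lebIcc : (lebIcc a b).map Subtype.val = volume.restrict (Icc a b) :=
  map_comap_subtype_coe measurableSet_Icc volume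

/-- Composing with `projIcc` extends functions on the subtype to `ℝ`, where the theory of interval
integrals applies. -/
theorem lebIcc_integrableOn_projIcc (hab : a ≤ b) {g : Icc a b → ℝ}
    (hg : Integrable g (lebIcc a b)) :
    IntegrableOn (fun u => g (projIcc a b hab u)) (Icc a b) := by
  rw [IntegrableOn, ← map_lebIcc,
    (MeasurableEmbedding.subtype_coe measurableSet_Icc).integrable_map_iff]
  exact hg.congr (ae_of_all _ fun t => by simp)

theorem lebIcc_ae_projIcc (hab : a ≤ b) {P : Icc a b → Prop} (h : ∀ᵐ t ∂(lebIcc a b), P t) :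
    ∀ᵐ u : ℝ, u ∈ Icc a b → P (projIcc a b hab u) := by
  rw [← ae_restrict_iff' measurableSet_Icc, ← map_lebIcc,
    (MeasurableEmbedding.subtype_coe measurableSet_Icc).ae_map_iff]
  filter_upwards [h] with t ht
  simpa using ht

theorem setIntegral_lebIcc_preimage (hab : a ≤ b) (g : Icc a b → ℝ) (A : Set ℝ)
    (hA : MeasurableSet A) :
    ∫ s in Subtype.val ⁻¹' A, g s ∂(lebIcc a b) =
      ∫ u in A ∩ Icc a b, g (projIcc a b hab u) := by
  rw [← Measure.restrict_restrict hA, ← map_lebIcc,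
    (MeasurableEmbedding.subtype_coe measurableSet_Icc).setIntegral_map]
  simp

theorem setIntegral_lebIcc_Ioc (hab : a ≤ b) (g : Icc a b → ℝ) {s t : Icc a b} (hst : s ≤ t) :
    ∫ u in Ioc s t, g u ∂(lebIcc a b) = ∫ u in (s : ℝ)..t, g (projIcc a b hab u) := by
  have h1 : Ioc s t = Subtype.val ⁻¹' Ioc (s : ℝ) t := rfl
  rw [h1, setIntegral_lebIcc_preimage hab g _ measurableSet_Ioc,
    intervalIntegral.integral_of_le hst, inter_eq_left.2]
  exact fun u hu => ⟨s.2.1.trans hu.1.le, hu.2.trans t.2.2⟩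

theorem setIntegral_lebIcc_Iic (hab : a ≤ b) (g : Icc a b → ℝ) (t : Icc a b) :
    ∫ u in Iic t, g u ∂(lebIcc a b) = ∫ u in a..t, g (projIcc a b hab u) := by
  have h1 : Iic t = Subtype.val ⁻¹' Iic (t : ℝ) := rfl
  have h2 : Iic (t : ℝ) ∩ Icc a b = Icc a t := by
    ext u
    exact ⟨fun h => ⟨h.2.1, h.1⟩, fun h => ⟨h.2, h.1, h.2.trans t.2.2⟩⟩
  rw [h1, setIntegral_lebIcc_preimage hab g _ measurableSet_Iic,
    intervalIntegral.integral_of_le t.2.1, h2, integral_Icc_eq_integral_Ioc]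

end Transfer

/-! ### Differentiability of primitives almost everywhere -/

section Primitive

variable {p : ℝ≥0∞} {a b : ℝ} [Fact (a < b)] {E : Type*} [AddCommGroup E] [Module ℝ E]
  [TopologicalSpace E] [IsTopologicalAddGroup E] [ContinuousSMul ℝ E]

/-- Constant functions in `ℒ^p`. -/
def CurlyLp.const (p : ℝ≥0∞) (a b : ℝ) (x : E) : CurlyLp p a b E :=
  ⟨fun _ => x, LusinMeasurable.of_continuous continuous_const, fun _ _ => memLp_const _⟩

theorem isPrimitiveOf_smul_const (p : ℝ≥0∞) (x : E) :
    IsPrimitiveOf ⟨fun t : Icc a b => (t : ℝ) • x, by fun_prop⟩ (CurlyLp.const p a b x) := by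
  intro t α
  refine ⟨integrable_const (α x), ?_⟩
  have hab : a ≤ b := (Fact.out : a < b).le
  rw [setIntegral_lebIcc_Iic hab (fun s => α ((CurlyLp.const p a b x).1 s))]
  change α ((t : ℝ) • x - a • x) = ∫ _ in a..t, α x
  rw [intervalIntegral.integral_const, ← sub_smul, map_smul]

theorem IsPrimitiveOf.sub {η ζ : C(Icc a b, E)} {γ δ : CurlyLp p a b E}
    (h : IsPrimitiveOf η γ) (h' : IsPrimitiveOf ζ δ) : IsPrimitiveOf (η - ζ) (γ - δ) := by
  have h3 := h.add (h'.smul (-1))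
  have e1 : η - ζ = η + (-1 : ℝ) • ζ := by
    ext t
    simp [sub_eq_add_neg]
  have e2 : γ - δ = γ + (-1 : ℝ) • δ := Subtype.ext (funext fun t => by simp [sub_eq_add_neg])
  rwa [e1, e2]

variable [Fact (1 ≤ p)] [LocallyConvexSpace ℝ E]

/-- The integral triangle inequality for `η - t • x`, a primitive of `γ - x`. Taking `x = 0`
controls increments of `η`; taking `x` close to `γ t` gives differentiability at `t`. -/
theorem IsPrimitiveOf.contSeminorm_sub_le {η : C(Icc a b, E)} {γ : CurlyLp p a b E}
    (h : IsPrimitiveOf η γ) (q : ContSeminorm E) (x : E) (hab : a ≤ b) (s t : Icc a b) :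
    q.1 (η t - η s - ((t : ℝ) - s) • x) ≤
      |∫ u in (s : ℝ)..t, q.1 (γ.1 (projIcc a b hab u) - x)| := by
  have key : ∀ s t : Icc a b, s ≤ t → q.1 (η t - η s - ((t : ℝ) - s) • x) ≤
      ∫ u in (s : ℝ)..t, q.1 (γ.1 (projIcc a b hab u) - x) := by
    intro s t hst
    have h1 := (h.sub (isPrimitiveOf_smul_const p x)).sub_Ioc hst
    have h2 := h1.contSeminorm_le q (CurlyLp.integrable (γ - CurlyLp.const p a b x) q).integrableOn
    rw [setIntegral_lebIcc_Ioc hab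
      (fun u => q.1 ((γ - CurlyLp.const p a b x).1 u)) hst] at h2
    refine le_trans (le_of_eq ?_) h2
    congr 1
    change _ = (η t - (t : ℝ) • x) - (η s - (s : ℝ) • x)
    rw [sub_smul]
    abel
  rcases le_total s t with hst | hst
  · exact (key s t hst).trans (le_abs_self _)
  · rw [intervalIntegral.integral_symm, abs_neg]
    refine le_trans (le_of_eq ?_) ((key t s hst).trans (le_abs_self _))
    rw [← map_neg_eq_map]
    congr 1
    rw [sub_smul, sub_smul]
    abel

/-- Up to a null set, the values lie in countably many compact images `γ '' C n`, each having finite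
`q`-nets of every radius `1 / (m + 1)`. -/
theorem LusinMeasurable.exists_countable_dense {γ : Icc a b → E}
    (hγ : LusinMeasurable γ (lebIcc a b)) (q : ContSeminorm E) :
    ∃ S : Set E, S.Countable ∧ ∀ᵐ t ∂(lebIcc a b), ∀ ε > 0, ∃ x ∈ S, q.1 (γ t - x) < ε := by
  obtain ⟨C, hC, hn⟩ := hγ univ isCompact_univ
  have hfin : ∀ n m : ℕ, ∃ T : Finset E, γ '' C n ⊆ ⋃ x ∈ T, {y | q.1 (y - x) < 1 / (m + 1 : ℝ)} := by
    intro n m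
    obtain ⟨T, -, hT⟩ := ((hC n).1.image_of_continuousOn (hC n).2.2).elim_nhds_subcover
      (fun x => {y | q.1 (y - x) < 1 / (m + 1 : ℝ)}) fun x _ => by
        refine (isOpen_lt (q.2.comp (continuous_id.sub continuous_const))
          continuous_const).mem_nhds ?_
        have : (0 : ℝ) < 1 / (m + 1) := by positivity
        simpa using this
    exact ⟨T, hT⟩
  choose T hT using hfin
  refine ⟨⋃ n, ⋃ m, (T n m : Set E), countable_iUnion fun n => countable_iUnion fun m =>
    (T n m).countable_toSet, ?_⟩
  rw [ae_iff]
  refine measure_mono_null (fun t ht => ?_) hn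
  refine ⟨mem_univ _, fun htC => ht fun ε hε => ?_⟩
  obtain ⟨n, hn⟩ := mem_iUnion.1 htC
  obtain ⟨m, hm⟩ := exists_nat_one_div_lt hε
  obtain ⟨x, hx, hxt⟩ := mem_iUnion₂.1 (hT n m ⟨t, hn, rfl⟩)
  exact ⟨x, mem_iUnion.2 ⟨n, mem_iUnion.2 ⟨m, hx⟩⟩, lt_trans hxt hm⟩

/-- A primitive is almost everywhere differentiable with respect to a given continuous
seminorm. -/
theorem IsPrimitiveOf.ae_tendsto {η : C(Icc a b, E)} {γ : CurlyLp p a b E}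
    (h : IsPrimitiveOf η γ) (q : ContSeminorm E) (hab : a ≤ b) :
    ∀ᵐ t : ℝ, t ∈ Icc a b → t ∈ Ioo a b ∧
      Tendsto (fun k : ℝ => k⁻¹ * q.1 (η (projIcc a b hab (t + k)) - η (projIcc a b hab t) -
        k • γ.1 (projIcc a b hab t))) (𝓝[≠] 0) (𝓝 0) := by
  obtain ⟨S, hS, hSd⟩ := γ.2.1.exists_countable_dense q
  have hint : ∀ x, IntervalIntegrable (fun u => q.1 (γ.1 (projIcc a b hab u) - x)) volume a b := by
    intro x
    rw [intervalIntegrable_iff_integrableOn_Icc_of_le hab]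
    exact lebIcc_integrableOn_projIcc hab (CurlyLp.integrable (γ - CurlyLp.const p a b x) q)
  -- Scalar Lebesgue differentiation of `q (γ - x)` for all `x ∈ S`: countability of `S` allows one
  -- exceptional null set.
  have hall := (ae_ball_iff hS).2 fun x _ => (hint x).ae_hasDerivAt_integral
  have ha : ∀ᵐ t : ℝ, t ≠ a := by simp [ae_iff, measure_singleton]
  have hb : ∀ᵐ t : ℝ, t ≠ b := by simp [ae_iff, measure_singleton]
  filter_upwards [hall, lebIcc_ae_projIcc hab hSd, ha, hb] with t ht htd hta htb htI
  have htoo : t ∈ Ioo a b := ⟨lt_of_le_of_ne htI.1 hta.symm, lt_of_le_of_ne htI.2 htb⟩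
  refine ⟨htoo, ?_⟩
  rw [Metric.tendsto_nhds]
  intro ε hε
  obtain ⟨x, hxS, hx⟩ := htd htI (ε / 2) (half_pos hε)
  have htu : t ∈ uIcc a b := by rwa [uIcc_of_le hab]
  have hder := ht x hxS htu t htu
  rw [hasDerivAt_iff_tendsto_slope_zero] at hder
  have hlim := hder.abs
  rw [abs_of_nonneg (apply_nonneg q.1 _)] at hlim
  have hmem : ∀ᶠ k : ℝ in 𝓝[≠] 0, t + k ∈ Icc a b := by
    have hcont : Continuous fun k : ℝ => t + k := by fun_prop
    refine nhdsWithin_le_nhds (hcont.continuousAt.eventually ?_)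
    exact Icc_mem_nhds (by simpa using htoo.1) (by simpa using htoo.2)
  filter_upwards [hlim.eventually (gt_mem_nhds hx), hmem, eventually_mem_nhdsWithin]
    with k hk hkI hk0
  have hk0 : k ≠ 0 := hk0
  have h1 := h.contSeminorm_sub_le q x hab (projIcc a b hab t) (projIcc a b hab (t + k))
  have e1 : ((projIcc a b hab t : Icc a b) : ℝ) = t := by rw [projIcc_of_mem hab htI]
  have e2 : ((projIcc a b hab (t + k) : Icc a b) : ℝ) = t + k := by rw [projIcc_of_mem hab hkI]
  rw [e1, e2, add_sub_cancel_left] at h1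
  simp only [intervalIntegral.integral_same, sub_zero, smul_eq_mul, abs_mul] at hk
  rw [Real.dist_eq, sub_zero, abs_mul, abs_of_nonneg (apply_nonneg q.1 _)]
  have hkpos : 0 < |k⁻¹| := abs_pos.2 (inv_ne_zero hk0)
  set Y := γ.1 (projIcc a b hab t)
  set D := η (projIcc a b hab (t + k)) - η (projIcc a b hab t)
  -- Replacing `Y = γ t` by the approximant `x ∈ S` costs less than `ε / 2` after division by `|k|`.
  have h2 : q.1 (D - k • Y) ≤ q.1 (D - k • x) + |k| * q.1 (Y - x) := by
    have h3 : D - k • Y = (D - k • x) - k • (Y - x) := by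
      rw [smul_sub]
      abel
    rw [h3, ← Real.norm_eq_abs, ← map_smul_eq_mul]
    exact map_sub_le_add q.1 _ _
  calc |k⁻¹| * q.1 (D - k • Y) ≤ |k⁻¹| * (q.1 (D - k • x) + |k| * q.1 (Y - x)) :=
        mul_le_mul_of_nonneg_left h2 hkpos.le
    _ = |k⁻¹| * q.1 (D - k • x) + q.1 (Y - x) := by
        rw [mul_add, abs_inv, inv_mul_cancel_left₀ (abs_ne_zero.2 hk0)]
    _ < ε / 2 + ε / 2 := add_lt_add_of_le_of_lt
        ((mul_le_mul_of_nonneg_left h1 hkpos.le).trans hk.le) hx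
    _ = ε := add_halves ε

end Primitive

/-! ### The chain rule -/

section ChainRule

variable {p : ℝ≥0∞} {a b : ℝ} {E : Type*} [AddCommGroup E] [Module ℝ E]
  [TopologicalSpace E] [IsTopologicalAddGroup E] [ContinuousSMul ℝ E] [LocallyConvexSpace ℝ E]
  {F : Type*} [AddCommGroup F] [Module ℝ F]
  [TopologicalSpace F] [IsTopologicalAddGroup F] [ContinuousSMul ℝ F] [LocallyConvexSpace ℝ F]
  [T2Space F] {V : Set E} {f : E → F} {df : E × E → F}

/-- Joint continuity of `df` preserves Lusin measurability, and near the compact image of `η` one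
has `q (df (η t, γ t)) ≤ r (γ t)`. -/
theorem HasDirDerivOn.comp_mem_curlyLp (hV : IsOpen V) (h1 : HasDirDerivOn f df V)
    (hc1 : ContinuousOn df (V ×ˢ univ)) (η : C(Icc a b, E)) (hη : ∀ t, η t ∈ V)
    (γ : CurlyLp p a b E) : (fun t => df (η t, γ.1 t)) ∈ CurlyLp p a b F := by
  have hL : LusinMeasurable (fun t => df (η t, γ.1 t)) (lebIcc a b) := by
    intro K hK
    obtain ⟨C, hC, hn⟩ := γ.2.1 K hK
    exact ⟨C, fun n => ⟨(hC n).1, (hC n).2.1, hc1.comp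
      (η.continuous.continuousOn.prodMk (hC n).2.2) fun t _ => ⟨hη t, mem_univ _⟩⟩, hn⟩
  refine ⟨hL, fun q hq => ?_⟩
  obtain ⟨r, hr⟩ := h1.exists_bound hV hc1 (isCompact_range η.continuous)
    (by rintro _ ⟨t, rfl⟩; exact hη t) ⟨q, hq⟩
  refine (γ.2.2 r.1 r.2).mono (hL.comp_continuous hq).aestronglyMeasurable (ae_of_all _ fun t => ?_)
  rw [Real.norm_of_nonneg (apply_nonneg _ _), Real.norm_of_nonneg (apply_nonneg _ _)]
  exact (hr (η t) ⟨t, rfl⟩ (η t) (by simp)).2 _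

/-- The seminorm `|α|`. -/
noncomputable def ContSeminorm.ofDual (α : F →L[ℝ] ℝ) : ContSeminorm F :=
  ⟨(normSeminorm ℝ ℝ).comp α.toLinearMap, continuous_norm.comp α.continuous⟩

theorem CurlyLp.integrable_dual [Fact (1 ≤ p)] (γ : CurlyLp p a b F) (α : F →L[ℝ] ℝ) :
    Integrable (fun t => α (γ.1 t)) (lebIcc a b) :=
  (integrable_norm_iff (γ.2.1.comp_continuous α.continuous).aestronglyMeasurable).1
    (CurlyLp.integrable γ (ContSeminorm.ofDual α))

/-- Domination at small `G`-distances suffices: running the definition for `G` with `min ε 1` makes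
every single increment smaller than `1`. -/
theorem absolutelyContinuousOnInterval_of_le_of_lt {g G : ℝ → ℝ}
    (hG : AbsolutelyContinuousOnInterval G a b)
    (h : ∀ x ∈ uIcc a b, ∀ y ∈ uIcc a b, dist (G x) (G y) < 1 → dist (g x) (g y) ≤ dist (G x) (G y)) :
    AbsolutelyContinuousOnInterval g a b := by
  rw [absolutelyContinuousOnInterval_iff] at hG ⊢
  intro ε hε
  obtain ⟨δ, hδ, hd⟩ := hG (min ε 1) (lt_min hε one_pos)
  refine ⟨δ, hδ, fun I hI hIδ => ?_⟩
  have h2 := hd I hI hIδ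
  refine (Finset.sum_le_sum fun i hi => ?_).trans_lt (h2.trans_le (min_le_left _ _))
  refine h _ (hI.1 i hi).1 _ (hI.1 i hi).2 ?_
  exact ((Finset.single_le_sum (f := fun i => dist (G (I.2 i).1) (G (I.2 i).2))
    (fun _ _ => dist_nonneg) hi).trans_lt h2).trans_le (min_le_right _ _)

/-- The `r`-unit ball around `x` is convex, so the mean value inequality applies on the segment from
`z` to `y`. -/
theorem HasDirDerivOn.dist_dual_le (h1 : HasDirDerivOn f df V) (α : F →L[ℝ] ℝ)
    {r : ContSeminorm E} {x : E}
    (hr : ∀ y, r.1 (y - x) < 1 → y ∈ V ∧ ∀ z, (ContSeminorm.ofDual α).1 (df (y, z)) ≤ r.1 z)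
    {y z : E} (hy : r.1 (y - x) < 1) (hz : r.1 (z - x) < 1) :
    |α (f y) - α (f z)| ≤ r.1 (y - z) := by
  have hseg : ∀ u ∈ Icc (0 : ℝ) 1, r.1 (z + u • (y - z) - x) < 1 := by
    intro u hu
    have h2 : z + u • (y - z) - x = (1 - u) • (z - x) + u • (y - x) := by
      module
    rw [h2]
    refine (map_add_le_add r.1 _ _).trans_lt ?_
    rw [map_smul_eq_mul, map_smul_eq_mul, Real.norm_of_nonneg hu.1,
      Real.norm_of_nonneg (sub_nonneg.2 hu.2)]
    rcases eq_or_lt_of_le hu.1 with h0 | h0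
    · rw [← h0]; simpa using hz
    · nlinarith [mul_lt_mul_of_pos_left hy h0, mul_le_mul_of_nonneg_left hz.le (sub_nonneg.2 hu.2)]
  have h3 := h1.contSeminorm_sub_sub_le (ContSeminorm.ofDual α) (x := z) (z := y - z) (w := 0)
    (M := r.1 (y - z)) (fun u hu => (hr _ (hseg u hu)).1) (fun u hu => by
      rw [sub_zero]
      exact (hr _ (hseg u hu)).2 _)
  rw [sub_zero, add_sub_cancel] at h3
  rw [← map_sub]
  exact h3

variable [Fact (a < b)] [Fact (1 ≤ p)]

/-- Compare `η (t + k)` with the tangent point `x + k • Y`. The local `r`-Lipschitz bound makes the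
discrepancy `o(k)` by `IsPrimitiveOf.ae_tendsto`, and along the tangent line the derivative is `α
(df (x, Y))`. -/
theorem HasDirDerivOn.ae_hasDerivAt_comp (h1 : HasDirDerivOn f df V)
    {η : C(Icc a b, E)} (hη : ∀ t, η t ∈ V)
    {γ : CurlyLp p a b E} (h : IsPrimitiveOf η γ) (hab : a ≤ b) (α : F →L[ℝ] ℝ)
    {r : ContSeminorm E} (hr : ∀ x ∈ range η, ∀ y, r.1 (y - x) < 1 →
      y ∈ V ∧ ∀ z, (ContSeminorm.ofDual α).1 (df (y, z)) ≤ r.1 z) :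
    ∀ᵐ t : ℝ, t ∈ Icc a b → HasDerivAt (fun t => α (f (η (projIcc a b hab t))))
      (α (df (η (projIcc a b hab t), γ.1 (projIcc a b hab t)))) t := by
  filter_upwards [h.ae_tendsto r hab] with t ht htI
  obtain ⟨htoo, hlim⟩ := ht htI
  set x := η (projIcc a b hab t) with hx
  set Y := γ.1 (projIcc a b hab t) with hY
  rw [hasDerivAt_iff_tendsto_slope_zero]
  have hl1 : Tendsto (fun k : ℝ => k⁻¹ • (α (f (x + k • Y)) - α (f x))) (𝓝[≠] 0)
      (𝓝 (α (df (x, Y)))) := by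
    refine ((α.continuous.tendsto _).comp (h1 x (hη _) Y)).congr fun k => ?_
    simp
  have hcη : Tendsto (fun k : ℝ => r.1 (η (projIcc a b hab (t + k)) - x)) (𝓝[≠] 0) (𝓝 0) := by
    have hc : Continuous fun k : ℝ => r.1 (η (projIcc a b hab (t + k)) - x) :=
      r.2.comp ((η.continuous.comp (continuous_projIcc.comp (by fun_prop))).sub continuous_const)
    refine (hc.tendsto' 0 0 ?_).mono_left nhdsWithin_le_nhds
    simp [hx]
  have hcY : Tendsto (fun k : ℝ => r.1 (x + k • Y - x)) (𝓝[≠] 0) (𝓝 0) := by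
    have hc : Continuous fun k : ℝ => r.1 (x + k • Y - x) := r.2.comp (by fun_prop)
    exact (hc.tendsto' 0 0 (by simp)).mono_left nhdsWithin_le_nhds
  have hl2 : Tendsto (fun k : ℝ => k⁻¹ • (α (f (η (projIcc a b hab (t + k)))) -
      α (f (x + k • Y)))) (𝓝[≠] 0) (𝓝 0) := by
    refine squeeze_zero_norm' ?_ (by simpa only [abs_zero] using hlim.abs)
    filter_upwards [hcη.eventually (gt_mem_nhds one_pos), hcY.eventually (gt_mem_nhds one_pos)]
      with k hk1 hk2
    rw [norm_smul, Real.norm_eq_abs, Real.norm_eq_abs, abs_mul,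
      abs_of_nonneg (apply_nonneg r.1 _)]
    refine mul_le_mul_of_nonneg_left ?_ (abs_nonneg _)
    refine (h1.dist_dual_le α (hr x ⟨_, rfl⟩) hk1 hk2).trans (le_of_eq ?_)
    rw [sub_sub]
  have hl3 := hl2.add hl1
  rw [zero_add] at hl3
  refine hl3.congr fun k => ?_
  rw [← smul_add, sub_add_sub_cancel]

/-- Chain rule for absolutely continuous functions. -/
theorem IsPrimitiveOf.comp (hV : IsOpen V) (hc : ContinuousOn f V) (h1 : HasDirDerivOn f df V)
    (hc1 : ContinuousOn df (V ×ˢ univ)) {η : C(Icc a b, E)} (hη : ∀ t, η t ∈ V)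
    {γ : CurlyLp p a b E} (h : IsPrimitiveOf η γ) :
    IsPrimitiveOf (⟨fun t => f (η t), hc.comp_continuous η.continuous hη⟩ : C(Icc a b, F))
      ⟨fun t => df (η t, γ.1 t), h1.comp_mem_curlyLp hV hc1 η hη γ⟩ := by
  have hab : a ≤ b := (Fact.out : a < b).le
  intro t α
  refine ⟨(CurlyLp.integrable_dual _ α).integrableOn, ?_⟩
  obtain ⟨r, hr⟩ := h1.exists_bound hV hc1 (isCompact_range η.continuous)
    (by rintro _ ⟨t, rfl⟩; exact hη t) (ContSeminorm.ofDual α)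
  set g : ℝ → ℝ := fun t => α (f (η (projIcc a b hab t))) with hg
  have hint : IntervalIntegrable (fun u => r.1 (γ.1 (projIcc a b hab u))) volume a b := by
    rw [intervalIntegrable_iff_integrableOn_Icc_of_le hab]
    exact lebIcc_integrableOn_projIcc hab (CurlyLp.integrable γ r)
  -- Increments of `g` are dominated by those of the primitive of `r ∘ γ`, as long as the latter are
  -- below `1`.
  have hAC : AbsolutelyContinuousOnInterval g a b := by
    refine absolutelyContinuousOnInterval_of_le_of_lt
      (hint.absolutelyContinuousOnInterval_intervalIntegral left_mem_uIcc) fun x hx y hy hxy => ?_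
    have hx' : x ∈ Icc a b := by rwa [uIcc_of_le hab] at hx
    have hy' : y ∈ Icc a b := by rwa [uIcc_of_le hab] at hy
    have h2 := h.contSeminorm_sub_le r 0 hab (projIcc a b hab y) (projIcc a b hab x)
    have e1 : ((projIcc a b hab x : Icc a b) : ℝ) = x := by rw [projIcc_of_mem hab hx']
    have e2 : ((projIcc a b hab y : Icc a b) : ℝ) = y := by rw [projIcc_of_mem hab hy']
    have hiy := hint.mono_set (uIcc_subset_uIcc left_mem_uIcc hy)
    have hix := hint.mono_set (uIcc_subset_uIcc left_mem_uIcc hx)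
    simp only [smul_zero, sub_zero, e1, e2] at h2
    rw [← intervalIntegral.integral_interval_sub_left hix hiy, ← Real.dist_eq] at h2
    refine le_trans ?_ h2
    rw [Real.dist_eq]
    exact h1.dist_dual_le α (hr _ ⟨projIcc a b hab y, rfl⟩) (h2.trans_lt hxy) (by simp)
  have htI : (t : ℝ) ∈ uIcc a b := by rw [uIcc_of_le hab]; exact t.2
  have hAC' := hAC.mono (uIcc_subset_uIcc left_mem_uIcc htI)
  have h3 := hAC'.integral_deriv_eq_sub
  have h4 : ∫ u in a..t, deriv g u =
      ∫ u in a..t, α (df (η (projIcc a b hab u), γ.1 (projIcc a b hab u))) := by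
    refine intervalIntegral.integral_congr_ae ?_
    filter_upwards [h1.ae_hasDerivAt_comp hη h hab α hr] with u hu huI
    rw [uIoc_of_le t.2.1] at huI
    exact (hu ⟨huI.1.le, huI.2.trans t.2.2⟩).deriv
  rw [setIntegral_lebIcc_Iic hab (fun s => α (df (η s, γ.1 s))), ← h4, h3, map_sub]
  simp only [hg, projIcc_val, projIcc_left]
  rfl

end ChainRule

/-! ### Superposition operators -/

section Superposition

variable {p : ℝ≥0∞} {a b : ℝ} [Fact (a < b)] [Fact (1 ≤ p)]
  {E : Type*} [AddCommGroup E] [Module ℝ E]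
  [TopologicalSpace E] [IsTopologicalAddGroup E] [ContinuousSMul ℝ E] [LocallyConvexSpace ℝ E]
  [T2Space E]
  {F : Type*} [AddCommGroup F] [Module ℝ F]
  [TopologicalSpace F] [IsTopologicalAddGroup F] [ContinuousSMul ℝ F] [LocallyConvexSpace ℝ F]
  [T2Space F] {V : Set E} {f : E → F} {df : E × E → F} {d2f : (E × E) × (E × E) → F}
  {d3f : ((E × E) × (E × E)) × ((E × E) × (E × E)) → F}

open Classical in
/-- The superposition operator `η ↦ f ∘ η` (with value `0` where `f ∘ η` is not in the space). -/
noncomputable def ACSpace.comp (f : E → F) (η : ACSpace p a b E) : ACSpace p a b F :=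
  if h : ∃ ζ : ACSpace p a b F, ∀ t, ζ t = f (η t) then h.choose else 0

theorem ACSpace.comp_eq (hV : IsOpen V) (hc : ContinuousOn f V) (h1 : HasDirDerivOn f df V)
    (hc1 : ContinuousOn df (V ×ˢ univ)) {η : ACSpace p a b E} (hη : η ∈ ACSpace.valuedIn V) :
    (ACSpace.comp f η).1 = ⟨fun t => f (η t), hc.comp_continuous η.1.continuous hη⟩ := by
  have hex : ∃ ζ : ACSpace p a b F, ∀ t, ζ t = f (η t) := by
    obtain ⟨γ, hγ⟩ := η.2
    exact ⟨⟨⟨fun t => f (η t), hc.comp_continuous η.1.continuous hη⟩, _,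
      hγ.comp hV hc h1 hc1 hη⟩, fun t => rfl⟩
  rw [ACSpace.comp, dif_pos hex]
  exact ContinuousMap.ext hex.choose_spec

theorem ACSpace.comp_apply (hV : IsOpen V) (hc : ContinuousOn f V) (h1 : HasDirDerivOn f df V)
    (hc1 : ContinuousOn df (V ×ˢ univ)) {η : ACSpace p a b E} (hη : η ∈ ACSpace.valuedIn V)
    (t : Icc a b) : ACSpace.comp f η t = f (η t) := by
  rw [ACSpace.comp_eq hV hc h1 hc1 hη]
  rfl

theorem ACSpace.comp_isPrimitiveOf (hV : IsOpen V) (hc : ContinuousOn f V)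
    (h1 : HasDirDerivOn f df V)
    (hc1 : ContinuousOn df (V ×ˢ univ)) {η : ACSpace p a b E} (hη : η ∈ ACSpace.valuedIn V)
    {γ : CurlyLp p a b E} (h : IsPrimitiveOf η.1 γ) :
    IsPrimitiveOf (ACSpace.comp f η).1
      ⟨fun t => df (η t, γ.1 t), h1.comp_mem_curlyLp hV hc1 η.1 hη γ⟩ := by
  rw [ACSpace.comp_eq hV hc h1 hc1 hη]
  exact h.comp hV hc h1 hc1 hη

theorem ACSpace.continuous_eval (t : Icc a b) : Continuous fun η : ACSpace p a b E => η t := by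
  obtain ⟨C, hC, hb⟩ := ACSpace.exists_sup_bound p a b E
  refine continuous_iff_continuousAt.2 fun η => tendsto_nhds_iff_contSeminorm.2 fun q ε hε => ?_
  have hcont : Continuous fun ζ : ACSpace p a b E => C * ACSpace.seminorm q (ζ - η) :=
    continuous_const.mul ((ACSpace.continuous_seminorm q).comp (continuous_id.sub continuous_const))
  have hlt : ∀ᶠ ζ in 𝓝 η, C * ACSpace.seminorm q (ζ - η) < ε :=
    hcont.continuousAt.eventually_lt continuousAt_const (by simpa using hε)
  filter_upwards [hlt] with ζ hζ
  exact (hb q (ζ - η) t).trans_lt hζ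

theorem ACSpace.range_subset {η : ACSpace p a b E} (hη : η ∈ ACSpace.valuedIn V) :
    range η.1 ⊆ V := by
  rintro _ ⟨t, rfl⟩
  exact hη t

/-- At the left endpoint continuity of `f` suffices. The derivative part is the pointwise estimate
`exists_lipschitz` with base displacement `ζ t - η t`, bounded uniformly, and directions `γ t`, `δ
t`, measured in `L^p`. -/
theorem ACSpace.continuousOn_comp (hV : IsOpen V) (hc : ContinuousOn f V)
    (h1 : HasDirDerivOn f df V) (hc1 : ContinuousOn df (V ×ˢ univ))
    (h2 : HasDirDerivOn df d2f (V ×ˢ univ)) (hc2 : ContinuousOn d2f ((V ×ˢ univ) ×ˢ univ)) :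
    ContinuousOn (ACSpace.comp f : ACSpace p a b E → ACSpace p a b F) (ACSpace.valuedIn V) := by
  intro η hη
  refine ACSpace.tendsto_nhds fun q ε hε => ?_
  obtain ⟨C, hC, hb⟩ := ACSpace.exists_sup_bound p a b E
  obtain ⟨r, hr⟩ := h1.exists_lipschitz hV hc1 h2 hc2 (isCompact_range η.1.continuous)
    (ACSpace.range_subset hη) q
  obtain ⟨γ, hγ, eγ⟩ := η.exists_primitive
  set N : ACSpace p a b E → ℝ := fun ζ => ACSpace.seminorm r (ζ - η) with hN
  have hNc : Continuous N :=
    (ACSpace.continuous_seminorm r).comp (continuous_id.sub continuous_const)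
  have hN0 : N η = 0 := by simp [hN]
  set A := leftEndpoint a b
  have hfA : Tendsto (fun ζ : ACSpace p a b E => q.1 (f (ζ A) - f (η A)))
      (𝓝[ACSpace.valuedIn V] η) (𝓝 0) := by
    have h3 : ContinuousWithinAt (fun ζ : ACSpace p a b E => f (ζ A)) (ACSpace.valuedIn V) η :=
      (hc (η A) (hη A)).comp (t := V)
        ((ACSpace.continuous_eval A).continuousWithinAt) fun ζ hζ => hζ A
    have h4 := (q.2.tendsto _).comp (Tendsto.sub_const h3 (f (η A)))
    simpa [Function.comp_def] using h4
  have hΦ : Tendsto (fun ζ : ACSpace p a b E => q.1 (f (ζ A) - f (η A)) +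
      (1 * N ζ + C * N ζ * LpSpace.seminorm r (LpSpace.mk γ)))
      (𝓝[ACSpace.valuedIn V] η) (𝓝 0) := by
    have h5 : Continuous fun ζ => 1 * N ζ + C * N ζ * LpSpace.seminorm r (LpSpace.mk γ) :=
      (continuous_const.mul hNc).add ((continuous_const.mul hNc).mul continuous_const)
    have h6 := hfA.add ((h5.tendsto' η 0 (by simp [hN0])).mono_left nhdsWithin_le_nhds)
    rwa [add_zero] at h6
  -- Keeps every `ζ t - η t` in the `r`-unit ball where the pointwise estimate holds.
  have hlt : ∀ᶠ ζ in 𝓝[ACSpace.valuedIn V] η, C * N ζ < 1 :=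
    nhdsWithin_le_nhds ((continuous_const.mul hNc).continuousAt.eventually_lt continuousAt_const
      (by simp [hN0]))
  filter_upwards [hΦ.eventually (gt_mem_nhds hε), hlt, eventually_mem_nhdsWithin] with ζ hζ hζ1 hζV
  refine lt_of_le_of_lt ?_ hζ
  obtain ⟨δ, hδ, eδ⟩ := ζ.exists_primitive
  have hP := (ACSpace.comp_isPrimitiveOf hV hc h1 hc1 hζV hδ).sub
    (ACSpace.comp_isPrimitiveOf hV hc h1 hc1 hη hγ)
  have hsup : ∀ t, r.1 (ζ t - η t) ≤ C * N ζ := fun t => hb r (ζ - η) t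
  rw [ACSpace.seminorm_apply, (ACSpace.comp f ζ - ACSpace.comp f η).deriv_eq hP]
  refine add_le_add (le_of_eq ?_) ?_
  · rw [← ACSpace.comp_apply hV hc h1 hc1 hζV, ← ACSpace.comp_apply hV hc h1 hc1 hη]
    rfl
  · have hCN : 0 ≤ C * N ζ := mul_nonneg hC (apply_nonneg _ _)
    refine (LpSpace.seminorm_mk_le q r r _ (δ - γ) γ zero_le_one hCN
      (ae_of_all _ fun t => ?_)).trans (add_le_add_left (mul_le_mul_of_nonneg_left ?_ zero_le_one) _)
    · have h7 := (hr (η t) ⟨t, rfl⟩ (ζ t - η t) ((hsup t).trans_lt hζ1)).2 (γ.1 t) (δ.1 t)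
      rw [add_sub_cancel] at h7
      refine h7.trans ?_
      rw [one_mul]
      exact add_le_add le_rfl (mul_le_mul_of_nonneg_right (hsup t) (apply_nonneg _ _))
    · rw [hN]
      simp only
      rw [ACSpace.seminorm_apply, (ζ - η).deriv_eq (hδ.sub hγ)]
      exact le_add_of_nonneg_left (apply_nonneg _ _)

/-- Two applications of the chain rule show that the remainder has as derivative exactly the
expression bounded in `exists_taylor`; the supremum bound `c` on `r (ζ t)` makes its `L^p`-seminorm
`O(|h|)`. -/
theorem ACSpace.hasDirDerivOn_comp (hV : IsOpen V) (hc : ContinuousOn f V)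
    (h1 : HasDirDerivOn f df V) (hc1 : ContinuousOn df (V ×ˢ univ))
    (h2 : HasDirDerivOn df d2f (V ×ˢ univ)) (hc2 : ContinuousOn d2f ((V ×ˢ univ) ×ˢ univ))
    (h3 : HasDirDerivOn d2f d3f ((V ×ˢ univ) ×ˢ univ))
    (hc3 : ContinuousOn d3f (((V ×ˢ univ) ×ˢ univ) ×ˢ univ)) :
    HasDirDerivOn (ACSpace.comp f : ACSpace p a b E → ACSpace p a b F)
      (fun x => ACSpace.comp df (ACSpace.pair x)) (ACSpace.valuedIn V) := by
  intro η hη ζ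
  refine ACSpace.tendsto_nhds fun q ε hε => ?_
  obtain ⟨C, hC, hb⟩ := ACSpace.exists_sup_bound p a b E
  obtain ⟨r, hr⟩ := h1.exists_taylor hV hc1 h2 hc2 h3 hc3 (isCompact_range η.1.continuous)
    (ACSpace.range_subset hη) q
  obtain ⟨γ, hγ, eγ⟩ := η.exists_primitive
  obtain ⟨δ, hδ, eδ⟩ := ζ.exists_primitive
  set c := C * ACSpace.seminorm r ζ
  have hc0 : 0 ≤ c := mul_nonneg hC (apply_nonneg _ _)
  have hsup : ∀ t, r.1 (ζ t) ≤ c := fun t => hb r ζ t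
  set A := leftEndpoint a b
  have hΦ : Tendsto (fun h : ℝ => q.1 (h⁻¹ • (f (η A + h • ζ A) - f (η A)) - df (η A, ζ A)) +
      (|h| * (c * c) * LpSpace.seminorm r (LpSpace.mk γ) +
        |h| * c * LpSpace.seminorm r (LpSpace.mk δ))) (𝓝[≠] 0) (𝓝 0) := by
    have h4 := (q.2.tendsto _).comp ((h1 (η A) (hη A) (ζ A)).sub_const (df (η A, ζ A)))
    have h5 : Continuous fun h : ℝ => |h| * (c * c) * LpSpace.seminorm r (LpSpace.mk γ) +
        |h| * c * LpSpace.seminorm r (LpSpace.mk δ) := by fun_prop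
    have h6 := h4.add ((h5.tendsto' 0 0 (by simp)).mono_left nhdsWithin_le_nhds)
    simpa using h6
  have hlt : ∀ᶠ h : ℝ in 𝓝[≠] 0, |h| * c < 1 := by
    have h5 : Continuous fun h : ℝ => |h| * c := by fun_prop
    exact nhdsWithin_le_nhds (h5.continuousAt.eventually_lt continuousAt_const (by simp))
  filter_upwards [hΦ.eventually (gt_mem_nhds hε), hlt, eventually_mem_nhdsWithin] with h hh hh1 hne
  have hne : h ≠ 0 := hne
  refine lt_of_le_of_lt ?_ hh
  have hest := fun t => hr (η t) ⟨t, rfl⟩ (ζ t) h hne (by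
    rw [map_smul_eq_mul, Real.norm_eq_abs]
    exact (mul_le_mul_of_nonneg_left (hsup t) (abs_nonneg h)).trans_lt hh1)
  have hmem : η + h • ζ ∈ ACSpace.valuedIn V := fun t => (hest t).1
  have hmem' : ACSpace.pair (η, ζ) ∈ ACSpace.valuedIn (V ×ˢ (univ : Set E)) :=
    fun t => ⟨hη t, mem_univ _⟩
  have hP := (((ACSpace.comp_isPrimitiveOf hV hc h1 hc1 hmem (hγ.add (hδ.smul h))).sub
    (ACSpace.comp_isPrimitiveOf hV hc h1 hc1 hη hγ)).smul h⁻¹).sub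
    (ACSpace.comp_isPrimitiveOf (hV.prod isOpen_univ) hc1 h2 hc2 hmem' (hγ.pair hδ))
  rw [ACSpace.seminorm_apply, (h⁻¹ • (ACSpace.comp f (η + h • ζ) - ACSpace.comp f η) -
    ACSpace.comp df (ACSpace.pair (η, ζ))).deriv_eq hP]
  refine add_le_add (le_of_eq ?_) ?_
  · have e1 := ACSpace.comp_apply hV hc h1 hc1 hmem A
    have e2 := ACSpace.comp_apply hV hc h1 hc1 hη A
    have e3 := ACSpace.comp_apply (hV.prod isOpen_univ) hc1 h2 hc2 hmem' A
    change q.1 (h⁻¹ • (ACSpace.comp f (η + h • ζ) A - ACSpace.comp f η A) -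
      ACSpace.comp df (ACSpace.pair (η, ζ)) A) = _
    rw [e1, e2, e3]
    rfl
  · refine LpSpace.seminorm_mk_le q r r _ γ δ (by positivity) (by positivity)
      (ae_of_all _ fun t => ((hest t).2 (γ.1 t) (δ.1 t)).trans ?_)
    have n0 := apply_nonneg r.1 (ζ t)
    have h7 := mul_le_mul (hsup t) (hsup t) n0 hc0
    exact add_le_add
      (mul_le_mul_of_nonneg_right (mul_le_mul_of_nonneg_left h7 (abs_nonneg h)) (apply_nonneg _ _))
      (mul_le_mul_of_nonneg_right (mul_le_mul_of_nonneg_left (hsup t) (abs_nonneg h))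
        (apply_nonneg _ _))

end Superposition

/-! ### Superposition operators as `C^n`-maps -/

section CnMaps

theorem isCnMapOn_succ {n : ℕ} {E : Type u} [AddCommGroup E] [Module ℝ E] [TopologicalSpace E]
    {F : Type v} [AddCommGroup F] [Module ℝ F] [TopologicalSpace F] {f : E → F} {U : Set E} :
    IsCnMapOn (n + 1) f U ↔ ContinuousOn f U ∧ ∃ df : E × E → F, HasDirDerivOn f df U ∧
      IsCnMapOn n df (U ×ˢ univ) := Iff.rfl

theorem IsCnMapOn.continuousOn {n : ℕ} {E : Type u} [AddCommGroup E] [Module ℝ E]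
    [TopologicalSpace E] {F : Type v} [AddCommGroup F] [Module ℝ F] [TopologicalSpace F]
    {f : E → F} {U : Set E} (h : IsCnMapOn n f U) : ContinuousOn f U := by
  cases n with
  | zero => exact h
  | succ n => exact h.1

/-- The directional derivative of `g ∘ L` is `dg ∘ (L × L)`, again of the form treated by the
induction. -/
theorem IsCnMapOn.comp_linearMap {n : ℕ} {X Y : Type u} [AddCommGroup X] [Module ℝ X]
    [TopologicalSpace X] [AddCommGroup Y] [Module ℝ Y] [TopologicalSpace Y]
    {F : Type v} [AddCommGroup F] [Module ℝ F] [TopologicalSpace F]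
    {g : Y → F} {U : Set Y} (h : IsCnMapOn n g U) (L : X →ₗ[ℝ] Y) (hL : Continuous L) :
    IsCnMapOn n (fun x => g (L x)) (L ⁻¹' U) := by
  induction n generalizing X Y with
  | zero => exact ContinuousOn.comp (t := U) h hL.continuousOn fun x hx => hx
  | succ n ih =>
    obtain ⟨hc, dg, hdg, h⟩ := isCnMapOn_succ.1 h
    refine isCnMapOn_succ.2 ⟨hc.comp hL.continuousOn fun x hx => hx,
      fun x => dg (L.prodMap L x), fun x hx y => ?_, ?_⟩
    · simpa using hdg (L x) hx (L y)
    · have h3 := ih h (L.prodMap L) (hL.prodMap hL)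
      have h4 : (L.prodMap L) ⁻¹' (U ×ˢ univ) = (L ⁻¹' U) ×ˢ univ := by
        ext x
        simp
      rwa [h4] at h3

/-- The induction varies `E`: the derivative is superposition with `df`, which is defined on `V × E`
and has one order of differentiability less than `f`. -/
theorem IsCnMapOn.acSpace_comp {p : ℝ≥0∞} {a b : ℝ} [Fact (a < b)] [Fact (1 ≤ p)] {n : ℕ}
    {E : Type u} [AddCommGroup E] [Module ℝ E] [TopologicalSpace E] [IsTopologicalAddGroup E]
    [ContinuousSMul ℝ E] [LocallyConvexSpace ℝ E] [T2Space E]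
    {F : Type v} [AddCommGroup F] [Module ℝ F] [TopologicalSpace F] [IsTopologicalAddGroup F]
    [ContinuousSMul ℝ F] [LocallyConvexSpace ℝ F] [T2Space F]
    {V : Set E} (hV : IsOpen V) {f : E → F} (hf : IsCnMapOn (n + 2) f V) :
    IsCnMapOn n (ACSpace.comp f : ACSpace p a b E → ACSpace p a b F) (ACSpace.valuedIn V) := by
  induction n generalizing E with
  | zero =>
    obtain ⟨hc, df, h1, hc1, d2f, h2, hc2⟩ := hf
    exact ACSpace.continuousOn_comp hV hc h1 hc1 h2 hc2
  | succ n ih =>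
    obtain ⟨hc, df, h1, hdf⟩ := isCnMapOn_succ.1 hf
    obtain ⟨hc1, d2f, h2, hd2f⟩ := isCnMapOn_succ.1 hdf
    obtain ⟨hc2, d3f, h3, hd3f⟩ := isCnMapOn_succ.1 hd2f
    refine isCnMapOn_succ.2 ⟨ACSpace.continuousOn_comp hV hc h1 hc1 h2 hc2, _,
      ACSpace.hasDirDerivOn_comp hV hc h1 hc1 h2 hc2 h3 hd3f.continuousOn, ?_⟩
    have h4 := (ih (hV.prod isOpen_univ) hdf).comp_linearMap
      (ACSpace.pair (p := p) (a := a) (b := b) (E := E) (G := E)) ACSpace.continuous_pair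
    have h5 : (ACSpace.pair (p := p) (a := a) (b := b) (E := E) (G := E)) ⁻¹'
        ACSpace.valuedIn (V ×ˢ univ) = ACSpace.valuedIn V ×ˢ univ := by
      ext x
      exact ⟨fun h => ⟨fun t => (h t).1, mem_univ _⟩, fun h t => ⟨h.1 t, mem_univ _⟩⟩
    rwa [h5] at h4

end CnMaps

theorem mainTheorem5
    {E : Type u} [AddCommGroup E] [Module ℝ E] [UniformSpace E] [IsUniformAddGroup E]
    [ContinuousSMul ℝ E] [LocallyConvexSpace ℝ E] [T2Space E]
    {F : Type v} [AddCommGroup F] [Module ℝ F] [UniformSpace F] [IsUniformAddGroup F]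
    [ContinuousSMul ℝ F] [LocallyConvexSpace ℝ F] [T2Space F]
    (hE : IsSeqCompleteSpace E) (hF : IsSeqCompleteSpace F)
    (a b : ℝ) [Fact (a < b)] (p : ℝ≥0∞) [Fact (1 ≤ p)] (k : ℕ∞)
    (V : Set E) (hV : IsOpen V) (f : E → F) (hf : IsCkMapOn (k + 2) f V) :
    IsOpen (ACSpace.valuedIn V : Set (ACSpace p a b E)) ∧
      ∃ P : ACSpace p a b E → ACSpace p a b F,
        (∀ η ∈ ACSpace.valuedIn V, ∀ t : Icc a b, P η t = f (η t)) ∧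
          IsCkMapOn k P (ACSpace.valuedIn V) := by
  refine ⟨ACSpace.isOpen_valuedIn hV, ACSpace.comp f, fun η hη t => ?_, fun n hn => ?_⟩
  -- The chain rule, which shows that `f ∘ η` is in the space, uses only that `f` is `C¹`.
  · have h1 : IsCnMapOn 1 f V := hf 1 (by
      calc ((1 : ℕ) : ℕ∞) ≤ 2 := by norm_num
        _ ≤ k + 2 := le_add_self)
    obtain ⟨hc, df, h1, hc1⟩ := h1
    exact ACSpace.comp_apply hV hc h1 hc1 hη t
  · refine (hf (n + 2) ?_).acSpace_comp hV
    push_cast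
    gcongr
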